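/- **Theorem (termination).** In the calculus of asynchronous binary sessions described below, let a system of global process definitions be given. If $P$ is a well-typed process (that is, $\vdash^n P :: \Gamma$ for some natural number $n$ and some finite typing context $\Gamma$) and no non-deterministic choice occurs in $P$ or in any definition that $P$ invokes, directly or through other definitions, then $P$ is *terminating*: every run of $P$ is finite. *Processes.* $P,Q ::= x\leftrightarrow y \mid x[\,] \mid x[a].P \mid x[y](P).Q \mid P\oplus Q \mid \mathsf{done} \mid A\langle\overline x\rangle \mid x().P \mid \mathsf{case}\,x\{a_i:P_i\}_{i\in I} \mid x(y).P \mid (x)(P\mid Q)$, with $I$ finite: link, signal output, tag output, channel output ($y$ is bound in $P$ only), choice, termination, invocation, signal input, tag input, channel input ($y$ bound in $P$), and composition ("cut", $x$ bound in $P$ and $Q$). Processes are identified up to renaming of bound channels. Each name $A$ has one definition $A(\overline x)=P$ with $\overline x$ distinct, $\mathrm{fn}(P)=\{\overline x\}$, and all invocations in $P$ guarded by a prefix or a choice. Buffers are $\mathcal B_x ::= [\,] \mid x[a].\mathcal B_x \mid x[y](P).\mathcal B_x$. *Structural pre-congruence* $\sqsupseteq$ is the least pre-congruence such that (no free channel being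 captured by a binder): - $A\langle\overline x\rangle\sqsupseteq P$ if $A(\overline x)=P$; $\;x\leftrightarrow y\sqsupseteq y\leftrightarrow x$; $\;(x)(P\mid Q)\sqsupseteq(x)(Q\mid P)$; - for $x\neq y$: $(x)(\mathcal B_x[y().P]\mid Q)\sqsupseteq y().(x)(\mathcal B_x[P]\mid Q)$; $\;(x)(\mathcal B_x[\mathsf{case}\,y\{a_i:P_i\}_{i\in I}]\mid Q)\sqsupseteq\mathsf{case}\,y\{a_i:(x)(\mathcal B_x[P_i]\mid Q)\}_{i\in I}$; $\;(x)(\mathcal B_x[y(z).P]\mid Q)\sqsupseteq y(z).(x)(\mathcal B_x[P]\mid Q)$; - for $x\neq y$: $(x)(\mathcal B_x[P]\mid\mathcal B'_x[x\leftrightarrow y])\sqsupseteq\mathcal B_y[(x)(P\mid\mathcal B'_x[x\leftrightarrow y])]$, where $\mathcal B_y=\mathcal B_x\{y/x\}$; - for $x\neq y$: $(x)(y[z](P).Q\mid R)\sqsupseteq y[z]((x)(P\mid R)).Q$ if $x\in\mathrm{fn}(P)\setminus\mathrm{fn}(Q)$; $\;(x)(\mathcal B_y[P]\mid Q)\sqsupseteq\mathcal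 B_y[(x)(P\mid Q)]$ if $x\notin\mathrm{fn}(\mathcal B_y)$; $\;\mathcal B_x[y[z](P).Q]\sqsupseteq y[z](\mathcal B_x[P]).Q$ and $\mathcal B_x[\mathcal B'_y[P]]\sqsupseteq\mathcal B'_y[\mathcal B_x[P]]$ if $x\in\mathrm{fn}(P)$. *Reduction* $\to$ is the least relation such that $P_1\oplus P_2\to P_k$ ($k=1,2$); $(x)(x\leftrightarrow y\mid P)\to P\{y/x\}$; $(x)(x[\,]\mid x().P)\to P$; $(x)(x[a_k].P\mid\mathcal B_x[\mathsf{case}\,x\{a_i:Q_i\}_{i\in I}])\to(x)(P\mid\mathcal B_x[Q_k])$ for $k\in I$; $(x)(x[y](P).Q\mid\mathcal B_x[x(y).R])\to(y)(P\mid(x)(Q\mid\mathcal B_x[R]))$; and if $P\to Q$ then $(x)(P\mid R)\to(x)(Q\mid R)$, $\mathcal B_x[P]\to\mathcal B_x[Q]$, and $P'\to Q$ whenever $P'\sqsupseteq P$. A *run* of $P$ is a maximal sequence $P=P_0\to P_1\to\cdots$: it is infinite or its last process does not reduce. *Session types* are the regular, possibly infinite trees generated by $S,T::=\mathbf 1\mid\bot\mid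 S\otimes T\mid S\mathbin{\wp}T\mid\oplus\{a_i^{m_i}:S_i\}_{i\in I}\mid\&\{a_i^{m_i}:S_i\}_{i\in I}$ (where $\wp$ denotes the multiplicative "par") with $I$ finite and $m_i\in\mathbb N$ the annotation of the tag $a_i$. Duality $S^\perp$ exchanges $\mathbf 1/\bot$, $\otimes/\mathbin{\wp}$ and $\oplus/\&$ everywhere. Types $\mathbf 1,\otimes,\oplus$ are positive. Transitions $S\xrightarrow{\alpha}T$ are given by bounded coinduction (derivations may be infinite, but every judgement in them must have a finite derivation in which the corule below may be used as well). Rules: $\mathbf 1\xrightarrow{!*}\mathbf 1$; $S\otimes T\xrightarrow{!S}T$; $\oplus\{a_i^{m_i}:S_i\}_{i\in I}\xrightarrow{!a_k^{m_k}}S_k$; if $T\xrightarrow{?\sigma}T'$ then $S\otimes T\xrightarrow{?\sigma}S\otimes T'$; if $S_i\xrightarrow{?\sigma}T_i$ for all $i\in I$ then $\oplus\{a_i^{m_i}:S_i\}_{i\in I}\xrightarrow{?\sigma}\oplus\{a_i^{m_i}:T_i\}_{i\in I}$. Corule: the last conclusion, with the premise for a single $k\in I$ only. The symmetric rules and corule,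 with $!$ and $?$ exchanged, hold for $\bot,\mathbin{\wp},\&$. A *correct asynchronous composition* is a relation $\mathcal R$ on types such that $(S,T)\in\mathcal R$ implies: $S$ or $T$ is positive; if $T\xrightarrow{!\sigma}T'$ with $\sigma$ the signal $*$ or an annotated tag, then $S\xrightarrow{?\sigma}S'$ with $(S',T')\in\mathcal R$; if $T\xrightarrow{!T_1}T_2$, then $S\xrightarrow{?S_1}S_2$ with $(S_1,T_1),(S_2,T_2)\in\mathcal R$; and symmetrically for the outputs of $S$. Write $S\bowtie T$ if some such $\mathcal R$ contains $(S,T)$. *Fair asynchronous subtyping*: $S\leqslant T$ iff $R\bowtie T$ implies $R\bowtie S$ for every session type $R$. *Typing* $\vdash^nP::\Gamma$, where $\Gamma$ is a finite map from channels to session types and $n\in\mathbb N$ is a measure, is defined coinductively by the following rules (in which the comma denotes the union of contexts with disjoint domains): - $\vdash^{n}\mathsf{done}::\emptyset$; $\;\vdash^{1+n}x[\,]::x:\mathbf 1$; $\;\vdash^{1+n}x\leftrightarrow y::x:S,y:T$ if $S^\perp\leqslant T$; - $\vdash^{m+n}A\langle\overline x\rangle::\overline{x:S}$ if $A(\overline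 x)=P$ and $\vdash^nP::\overline{x:S}$; - $\vdash^{1+n_k}P_1\oplus P_2::\Gamma$ if $\vdash^{n_i}P_i::\Gamma$ for $i=1,2$, where $k\in\{1,2\}$; - $\vdash^{m+n}(x)(P\mid Q)::\Gamma,\Delta$ if $\vdash^mP::\Gamma,x:S$ and $\vdash^nQ::\Delta,x:T$ and $S\bowtie T$; - $\vdash^nx().P::\Gamma,x:\bot$ if $\vdash^nP::\Gamma$; - $\vdash^{1+m_k+n}x[a_k].P::\Gamma,x:\oplus\{a_i^{m_i}:S_i\}_{i\in I}$ if $k\in I$ and $\vdash^nP::\Gamma,x:S_k$; - $\vdash^n\mathsf{case}\,x\{a_i:P_i\}_{i\in I}::\Gamma,x:\&\{a_i^{m_i}:S_i\}_{i\in J}$ if $J\subseteq I$, $\vdash^{n+m_i}P_i::\Gamma,x:S_i$ for all $i\in J$, and $\mathrm{fn}(P_i)\subseteq\mathrm{dom}(\Gamma)\cup\{x\}$ for all $i\in I\setminus J$; - $\vdash^{1+m+n}x[y](P).Q::\Gamma,\Delta,x:T\otimes S$ if $\vdash^mP::\Gamma,y:T$ and $\vdash^nQ::\Delta,x:S$;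 - $\vdash^nx(y).P::\Gamma,x:T\mathbin{\wp}S$ if $\vdash^nP::\Gamma,y:T,x:S$. -/

import Mathlib

/-!
# Asynchronous binary sessions: processes, session types, typing

`Tag` is the set of tags and `Nm` the set of process names; channels are natural numbers
(any infinite set with decidable equality would do).
-/

namespace CaP

/-! ## Processes -/

abbrev Chan := ℕ

inductive Proc (Tag Nm : Type) : Type
  | link (x y : Chan)
  | close (x : Chan)
  | select (x : Chan) (a : Tag) (P : Proc Tag Nm)
  /-- output on `x` of a fresh channel `y`, bound in `P` but not in `Q` -/
  | fork (x y : Chan) (P Q : Proc Tag Nm)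
  | choice (P Q : Proc Tag Nm)
  | done
  | call (A : Nm) (xs : List Chan)
  | wait (x : Chan) (P : Proc Tag Nm)
  | case (x : Chan) (I : Finset Tag) (P : {a // a ∈ I} → Proc Tag Nm)
  /-- input from `x` of a channel `y`, bound in `P` -/
  | join (x y : Chan) (P : Proc Tag Nm)
  /-- parallel composition of `P` and `Q` connected by `x`, bound in both -/
  | cut (x : Chan) (P Q : Proc Tag Nm)

variable {Tag Nm : Type}

namespace Proc

/-- Free channels. -/
def fn : Proc Tag Nm → Finset Chan
  | link x y => {x, y}
  | close x => {x}
  | select x _ P => insert x (fn P)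
  | fork x y P Q => insert x ((fn P).erase y ∪ fn Q)
  | choice P Q => fn P ∪ fn Q
  | done => ∅
  | call _ xs => xs.toFinset
  | wait x P => insert x (fn P)
  | case x I P => insert x (I.attach.biUnion fun a => fn (P a))
  | join x y P => insert x ((fn P).erase y)
  | cut x P Q => (fn P ∪ fn Q).erase x

end Proc

/-- A channel that does not belong to `s`. -/
def fresh (s : Finset Chan) : Chan := s.sup id + 1

namespace Proc

/-- Capture-avoiding simultaneous renaming of the free channels: each binder is renamed to a channel
that is not the image of any channel occurring free in its scope. -/
def rename : (Chan → Chan) → Proc Tag Nm → Proc Tag Nm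
  | ρ, link x y => link (ρ x) (ρ y)
  | ρ, close x => close (ρ x)
  | ρ, select x a P => select (ρ x) a (rename ρ P)
  | ρ, fork x y P Q =>
      let z := fresh (((fn P).erase y).image ρ)
      fork (ρ x) z (rename (Function.update ρ y z) P) (rename ρ Q)
  | ρ, choice P Q => choice (rename ρ P) (rename ρ Q)
  | _, done => done
  | ρ, call A xs => call A (xs.map ρ)
  | ρ, wait x P => wait (ρ x) (rename ρ P)
  | ρ, case x I P => case (ρ x) I fun a => rename ρ (P a)
  | ρ, join x y P =>
      let z := fresh (((fn P).erase y).image ρ)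
      join (ρ x) z (rename (Function.update ρ y z) P)
  | ρ, cut x P Q =>
      let z := fresh (((fn P ∪ fn Q).erase x).image ρ)
      cut z (rename (Function.update ρ x z) P) (rename (Function.update ρ x z) Q)

/-- `P.subst x y` is `P{y/x}`. -/
def subst (x y : Chan) (P : Proc Tag Nm) : Proc Tag Nm := rename (Function.update id x y) P

/-- No invocation occurs outside the scope of all prefixes and non-deterministic choices. -/
def Guarded : Proc Tag Nm → Prop
  | call _ _ => False
  | cut _ P Q => Guarded P ∧ Guarded Q
  | _ => True

/-- The process text contains no non-deterministic choice. -/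
def ChoiceFree : Proc Tag Nm → Prop
  | choice _ _ => False
  | select _ _ P => ChoiceFree P
  | fork _ _ P Q => ChoiceFree P ∧ ChoiceFree Q
  | wait _ P => ChoiceFree P
  | case _ _ P => ∀ a, ChoiceFree (P a)
  | join _ _ P => ChoiceFree P
  | cut _ P Q => ChoiceFree P ∧ ChoiceFree Q
  | _ => True

/-- The process text contains an invocation of the name `A`. -/
def Invokes (A : Nm) : Proc Tag Nm → Prop
  | call B _ => A = B
  | choice P Q => Invokes A P ∨ Invokes A Q
  | select _ _ P => Invokes A P
  | fork _ _ P Q => Invokes A P ∨ Invokes A Q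
  | wait _ P => Invokes A P
  | case _ _ P => ∃ a, Invokes A (P a)
  | join _ _ P => Invokes A P
  | cut _ P Q => Invokes A P ∨ Invokes A Q
  | _ => False

end Proc

/-- A global definition `A(params) = body`. -/
structure ProcDef (Tag Nm : Type) where
  params : List Chan
  body : Proc Tag Nm

/-- Every process name has exactly one definition. -/
abbrev Program (Tag Nm : Type) := Nm → ProcDef Tag Nm

structure Program.WellFormed (D : Program Tag Nm) : Prop where
  nodup : ∀ A, (D A).params.Nodup
  fn_body : ∀ A, (D A).body.fn = (D A).params.toFinset
  guarded : ∀ A, (D A).body.Guarded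

/-- The function on channels that sends the formal parameters `ps` to the actual ones `xs`, in
order, and fixes all other channels. -/
def paramMap : List Chan → List Chan → Chan → Chan
  | p :: ps, x :: xs => Function.update (paramMap ps xs) p x
  | _, _ => id

/-- `D.unfold A xs` is the body of the definition of `A`, where `xs` replace the parameters. -/
def Program.unfold (D : Program Tag Nm) (A : Nm) (xs : List Chan) : Proc Tag Nm :=
  (D A).body.rename (paramMap (D A).params xs)

/-- The names of the definitions that `P` depends on, directly or through other definitions. -/
inductive Program.Uses (D : Program Tag Nm) (P : Proc Tag Nm) : Nm → Prop
  | direct {A : Nm} : P.Invokes A → Uses D P A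
  | indirect {A B : Nm} : Uses D P A → (D A).body.Invokes B → Uses D P B

/-- `P` contains no non-deterministic choice, neither in its own text nor in that of a definition it
depends on. -/
def Program.NoChoice (D : Program Tag Nm) (P : Proc Tag Nm) : Prop :=
  P.ChoiceFree ∧ ∀ A, D.Uses P A → (D A).body.ChoiceFree

/-! ## Buffers -/

/-- A message in a buffer: a tag, or a fresh channel `y` with its associated process `P`. -/
inductive Msg (Tag Nm : Type) : Type
  | tag (a : Tag)
  | chan (y : Chan) (P : Proc Tag Nm)

/-- A buffer, without the channel the messages have been sent on. -/
abbrev Buffer (Tag Nm : Type) := List (Msg Tag Nm)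

/-- `B.fill x P` is the process `𝓑ₓ[P]`. -/
def Buffer.fill (x : Chan) : Buffer Tag Nm → Proc Tag Nm → Proc Tag Nm
  | [], P => P
  | .tag a :: B, P => .select x a (Buffer.fill x B P)
  | .chan y R :: B, P => .fork x y R (Buffer.fill x B P)

/-- Channels occurring free in the messages (the subject of the buffer is dealt with apart). -/
def Buffer.fn : Buffer Tag Nm → Finset Chan
  | [] => ∅
  | .tag _ :: B => Buffer.fn B
  | .chan y R :: B => R.fn.erase y ∪ Buffer.fn B

/-- Replacement of `x` by `y` in the messages. -/
def Buffer.subst (x y : Chan) : Buffer Tag Nm → Buffer Tag Nm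
  | [] => []
  | .tag a :: B => .tag a :: Buffer.subst x y B
  | .chan u R :: B =>
      let z := fresh ((R.fn.erase u).image (Function.update id x y))
      .chan z (R.rename (Function.update (Function.update id x y) u z)) :: Buffer.subst x y B

/-! ## Alpha-equivalence, structural pre-congruence, reduction -/

/-- The least pre-congruence (reflexive, transitive and compatible with all process forms) that
contains `R`. -/
inductive PreCong (R : Proc Tag Nm → Proc Tag Nm → Prop) : Proc Tag Nm → Proc Tag Nm → Prop
  | base {P Q} : R P Q → PreCong R P Q
  | refl (P) : PreCong R P P
  | trans {P Q S} : PreCong R P Q → PreCong R Q S → PreCong R P S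
  | select (x a) {P P'} : PreCong R P P' → PreCong R (.select x a P) (.select x a P')
  | fork (x y) {P P' Q Q'} : PreCong R P P' → PreCong R Q Q' →
      PreCong R (.fork x y P Q) (.fork x y P' Q')
  | choice {P P' Q Q'} : PreCong R P P' → PreCong R Q Q' →
      PreCong R (.choice P Q) (.choice P' Q')
  | wait (x) {P P'} : PreCong R P P' → PreCong R (.wait x P) (.wait x P')
  | case (x I) {P P' : {a // a ∈ I} → Proc Tag Nm} : (∀ a, PreCong R (P a) (P' a)) →
      PreCong R (.case x I P) (.case x I P')
  | join (x y) {P P'} : PreCong R P P' → PreCong R (.join x y P) (.join x y P')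
  | cut (x) {P P' Q Q'} : PreCong R P P' → PreCong R Q Q' →
      PreCong R (.cut x P Q) (.cut x P' Q')

/-- Renaming of one bound channel, at the top of a process. -/
inductive AlphaStep : Proc Tag Nm → Proc Tag Nm → Prop
  | fork {x y z P Q} : z ∉ P.fn → AlphaStep (.fork x y P Q) (.fork x z (P.subst y z) Q)
  | join {x y z P} : z ∉ P.fn → AlphaStep (.join x y P) (.join x z (P.subst y z))
  | cut {x z P Q} : z ∉ P.fn → z ∉ Q.fn →
      AlphaStep (.cut x P Q) (.cut z (P.subst x z) (Q.subst x z))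

/-- Equality up to renaming of bound channels. -/
def AlphaEq : Proc Tag Nm → Proc Tag Nm → Prop :=
  PreCong fun P Q => AlphaStep P Q ∨ AlphaStep Q P

/-- The axioms of structural pre-congruence. The first one makes it act on processes up to renaming
of bound channels; the freshness conditions on the binders that are moved say that no free channel
is captured. -/
inductive StrStep (D : Program Tag Nm) : Proc Tag Nm → Proc Tag Nm → Prop
  | alpha {P Q} : AlphaEq P Q → StrStep D P Q
  | call {A xs} : xs.length = (D A).params.length → StrStep D (.call A xs) (D.unfold A xs)
  | link {x y} : StrStep D (.link x y) (.link y x)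
  | comm {x P Q} : StrStep D (.cut x P Q) (.cut x Q P)
  | wait {x y P Q} (B : Buffer Tag Nm) : x ≠ y →
      StrStep D (.cut x (B.fill x (.wait y P)) Q) (.wait y (.cut x (B.fill x P) Q))
  | case {x y I P Q} (B : Buffer Tag Nm) : x ≠ y →
      StrStep D (.cut x (B.fill x (.case y I P)) Q)
        (.case y I fun a => .cut x (B.fill x (P a)) Q)
  | join {x y z P Q} (B : Buffer Tag Nm) : x ≠ y → z ∉ B.fn → z ≠ x → z ∉ Q.fn →
      StrStep D (.cut x (B.fill x (.join y z P)) Q) (.join y z (.cut x (B.fill x P) Q))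
  | pull0 {x y P} (B B' : Buffer Tag Nm) : x ≠ y →
      StrStep D (.cut x (B.fill x P) (B'.fill x (.link x y)))
        ((B.subst x y).fill y (.cut x P (B'.fill x (.link x y))))
  | pull1 {x y z P Q R} : x ≠ y → x ∈ P.fn → x ∉ Q.fn → z ≠ x → z ∉ R.fn →
      StrStep D (.cut x (.fork y z P Q) R) (.fork y z (.cut x P R) Q)
  | pull2 {x y P Q} (B : Buffer Tag Nm) : x ≠ y → x ∉ B.fn →
      StrStep D (.cut x (B.fill y P) Q) (B.fill y (.cut x P Q))
  | pull3 {x y z P Q} (B : Buffer Tag Nm) : x ≠ y → x ∈ P.fn → z ≠ x → z ∉ B.fn →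
      StrStep D (B.fill x (.fork y z P Q)) (.fork y z (B.fill x P) Q)
  | pull4 {x y P} (B B' : Buffer Tag Nm) : x ≠ y → x ∈ P.fn →
      StrStep D (B.fill x (B'.fill y P)) (B'.fill y (B.fill x P))

/-- Structural pre-congruence `P ⊒ Q`. -/
def Str (D : Program Tag Nm) : Proc Tag Nm → Proc Tag Nm → Prop := PreCong (StrStep D)

/-- Reduction `P → Q`. -/
inductive Red (D : Program Tag Nm) : Proc Tag Nm → Proc Tag Nm → Prop
  | choiceL {P Q} : Red D (.choice P Q) P
  | choiceR {P Q} : Red D (.choice P Q) Q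
  | link {x y P} : Red D (.cut x (.link x y) P) (P.subst x y)
  | close {x P} : Red D (.cut x (.close x) (.wait x P)) P
  | select {x I P} {Q : {a // a ∈ I} → Proc Tag Nm} (B : Buffer Tag Nm) (k : {a // a ∈ I}) :
      Red D (.cut x (.select x k P) (B.fill x (.case x I Q))) (.cut x P (B.fill x (Q k)))
  | fork {x y P Q R} (B : Buffer Tag Nm) : y ≠ x → y ∉ Q.fn → y ∉ B.fn →
      Red D (.cut x (.fork x y P Q) (B.fill x (.join x y R)))
        (.cut y P (.cut x Q (B.fill x R)))
  | cut {x P Q R} : Red D P Q → Red D (.cut x P R) (.cut x Q R)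
  | buffer {x P Q} (B : Buffer Tag Nm) : Red D P Q → Red D (B.fill x P) (B.fill x Q)
  | str {P R Q} : Str D P R → Red D R Q → Red D P Q

/-- The sequence `s 0, s 1, …` of `len` reductions (`len` may be infinite) is a reduction sequence
of `P`; the values of `s` beyond `len` are irrelevant. -/
def IsReductionSeq (D : Program Tag Nm) (P : Proc Tag Nm) (s : ℕ → Proc Tag Nm) (len : ℕ∞) : Prop :=
  s 0 = P ∧ ∀ i : ℕ, ((i + 1 : ℕ) : ℕ∞) ≤ len → Red D (s i) (s (i + 1))

/-- A run is a maximal reduction sequence: it is infinite or its last process does not reduce. -/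
def IsRun (D : Program Tag Nm) (P : Proc Tag Nm) (s : ℕ → Proc Tag Nm) (len : ℕ∞) : Prop :=
  IsReductionSeq D P s len ∧ ∀ n : ℕ, len = n → ∀ Q, ¬ Red D (s n) Q

/-- Every run of `P` is finite. -/
def Terminating (D : Program Tag Nm) (P : Proc Tag Nm) : Prop :=
  ∀ s len, IsRun D P s len → len ≠ ⊤

/-! ## Session types

A polarity is a Boolean: `true` for positive (output), `false` for negative (input). Thus
`unit true = 𝟏`, `unit false = ⊥`, `mult true T S = T ⊗ S`, `mult false T S = T ⅋ S`,
`branch true I m S = ⊕{aᵐ⁽ᵃ⁾ : S a}` and `branch false I m S = &{aᵐ⁽ᵃ⁾ : S a}` for `a ∈ I`, where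
the natural number `m a` is the annotation of the tag `a`. -/

inductive Shape (Tag : Type) : Type
  | unit (p : Bool)
  | mult (p : Bool)
  | branch (p : Bool) (I : Finset Tag) (m : {a // a ∈ I} → ℕ)

/-- The index type of the immediate subtrees; for `mult`, `true` is the type of the exchanged channel
and `false` that of the continuation. -/
def Shape.Arity : Shape Tag → Type
  | unit _ => Empty
  | mult _ => Bool
  | branch _ I _ => {a // a ∈ I}

def treeFunctor (Tag : Type) : PFunctor.{0, 0} := ⟨Shape Tag, Shape.Arity⟩

/-- Possibly infinite trees. -/
abbrev Tree (Tag : Type) := (treeFunctor Tag).M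

namespace Tree

def unit (p : Bool) : Tree Tag :=
  PFunctor.M.mk (F := treeFunctor Tag) ⟨Shape.unit p, fun i : Empty => i.elim⟩

def mult (p : Bool) (T S : Tree Tag) : Tree Tag :=
  PFunctor.M.mk (F := treeFunctor Tag) ⟨Shape.mult p, fun b : Bool => if b then T else S⟩

def branch (p : Bool) (I : Finset Tag) (m : {a // a ∈ I} → ℕ) (S : {a // a ∈ I} → Tree Tag) :
    Tree Tag :=
  PFunctor.M.mk (F := treeFunctor Tag) ⟨Shape.branch p I m, S⟩

/-- The polarity of the topmost constructor. -/
def pol (S : Tree Tag) : Bool :=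
  match S.dest with
  | ⟨Shape.unit p, _⟩ => p
  | ⟨Shape.mult p, _⟩ => p
  | ⟨Shape.branch p _ _, _⟩ => p

/-- Duality: it flips the polarity of every node. -/
def dual : Tree Tag → Tree Tag :=
  PFunctor.M.corec (F := treeFunctor Tag) fun S =>
    match S.dest with
    | ⟨Shape.unit p, f⟩ => ⟨Shape.unit (!p), f⟩
    | ⟨Shape.mult p, f⟩ => ⟨Shape.mult (!p), f⟩
    | ⟨Shape.branch p I m, f⟩ => ⟨Shape.branch (!p) I m, f⟩

/-- `Subtree T S`: `T` is a subtree of `S`. -/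
inductive Subtree : Tree Tag → Tree Tag → Prop
  | refl (S) : Subtree S S
  | child {T S : Tree Tag} (i : (treeFunctor Tag).B S.dest.1) :
      Subtree T (S.dest.2 i) → Subtree T S

/-- Regular trees have finitely many distinct subtrees; session types are the regular trees. -/
def Regular (S : Tree Tag) : Prop := {T | Subtree T S}.Finite

end Tree

/-! ## Asynchronous transitions of session types -/

/-- What is exchanged: a termination signal, an annotated tag, or a channel of a given type. -/
inductive Obj (Tag : Type) : Type
  | star
  | tag (a : Tag) (m : ℕ)
  | chan (T : Tree Tag)

/-- One application of a rule of the (coinductively read) inference system, with premises in `X`. In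
a judgement `S, p, σ, T` the polarity `p` is `true` for the output `!σ` and `false` for the input
`?σ`. The `must` rules are immediate transitions, the `may` rules are early outputs and late inputs. -/
inductive LRule (X : Tree Tag → Bool → Obj Tag → Tree Tag → Prop) :
    Tree Tag → Bool → Obj Tag → Tree Tag → Prop
  | mustUnit (p) : LRule X (.unit p) p .star (.unit p)
  | mustMult (p T S) : LRule X (.mult p T S) p (.chan T) S
  | mustBranch (p I m S) (k : {a // a ∈ I}) : LRule X (.branch p I m S) p (.tag k (m k)) (S k)
  | mayMult {p T S σ S'} : X S (!p) σ S' → LRule X (.mult p T S) (!p) σ (.mult p T S')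
  | mayBranch {p I m σ} {S S' : {a // a ∈ I} → Tree Tag} : (∀ a, X (S a) (!p) σ (S' a)) →
      LRule X (.branch p I m S) (!p) σ (.branch p I m S')

/-- Inductive derivability from the rules and the corule `fair`, which has a single premise. -/
inductive IndTrans : Tree Tag → Bool → Obj Tag → Tree Tag → Prop
  | mustUnit (p) : IndTrans (.unit p) p .star (.unit p)
  | mustMult (p T S) : IndTrans (.mult p T S) p (.chan T) S
  | mustBranch (p I m S) (k : {a // a ∈ I}) : IndTrans (.branch p I m S) p (.tag k (m k)) (S k)
  | mayMult {p T S σ S'} : IndTrans S (!p) σ S' → IndTrans (.mult p T S) (!p) σ (.mult p T S')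
  | mayBranch {p I m σ} {S S' : {a // a ∈ I} → Tree Tag} : (∀ a, IndTrans (S a) (!p) σ (S' a)) →
      IndTrans (.branch p I m S) (!p) σ (.branch p I m S')
  | fair {p I m σ} {S S' : {a // a ∈ I} → Tree Tag} (k : {a // a ∈ I}) :
      IndTrans (S k) (!p) σ (S' k) → IndTrans (.branch p I m S) (!p) σ (.branch p I m S')

/-- The transition relation, by bounded coinduction: the judgements that have a possibly infinite
derivation by the rules in which every judgement has a finite derivation by rules and corule. -/
def Trans (S : Tree Tag) (p : Bool) (σ : Obj Tag) (T : Tree Tag) : Prop :=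
  ∃ X : Tree Tag → Bool → Obj Tag → Tree Tag → Prop,
    (∀ S p σ T, X S p σ T → LRule X S p σ T ∧ IndTrans S p σ T) ∧ X S p σ T

/-! ## Correct composition and fair asynchronous subtyping -/

/-- `R` is a correct asynchronous composition. -/
structure IsCorrectComp (R : Tree Tag → Tree Tag → Prop) : Prop where
  pp : ∀ S T, R S T → S.pol = true ∨ T.pol = true
  io : ∀ S T, R S T → ∀ σ T', (∀ U, σ ≠ .chan U) → Trans T true σ T' →
    ∃ S', Trans S false σ S' ∧ R S' T'
  oi : ∀ S T, R S T → ∀ σ S', (∀ U, σ ≠ .chan U) → Trans S true σ S' →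
    ∃ T', Trans T false σ T' ∧ R S' T'
  ios : ∀ S T, R S T → ∀ T₁ T₂, Trans T true (.chan T₁) T₂ →
    ∃ S₁ S₂, Trans S false (.chan S₁) S₂ ∧ R S₁ T₁ ∧ R S₂ T₂
  ois : ∀ S T, R S T → ∀ S₁ S₂, Trans S true (.chan S₁) S₂ →
    ∃ T₁ T₂, Trans T false (.chan T₁) T₂ ∧ R S₁ T₁ ∧ R S₂ T₂

/-- `S` and `T` compose correctly: some correct asynchronous composition relates them. -/
def Correct (S T : Tree Tag) : Prop := ∃ R, IsCorrectComp R ∧ R S T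

/-- Fair asynchronous subtyping `S ≤ T`: every session type that composes correctly with `T` also
composes correctly with `S`. -/
def Sub (S T : Tree Tag) : Prop := ∀ R : Tree Tag, R.Regular → Correct R T → Correct R S

/-! ## Typing -/

/-- Typing contexts: partial maps from channels to types. -/
abbrev Ctx (Tag : Type) := Chan → Option (Tree Tag)

namespace Ctx

def empty : Ctx Tag := fun _ => none

/-- `Γ, x : S` (used for `x` outside the domain of `Γ`). -/
def ext (Γ : Ctx Tag) (x : Chan) (S : Tree Tag) : Ctx Tag := Function.update Γ x (some S)

def Disjoint (Γ Δ : Ctx Tag) : Prop := ∀ z, Γ z = none ∨ Δ z = none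

/-- `Γ, Δ` (used for contexts with disjoint domains). -/
def union (Γ Δ : Ctx Tag) : Ctx Tag := fun z => (Γ z).or (Δ z)

def dom (Γ : Ctx Tag) : Set Chan := {z | Γ z ≠ none}

end Ctx

/-- One application of a typing rule, with premises in `X`; the number is the measure. -/
inductive TypingRule (D : Program Tag Nm) (X : ℕ → Proc Tag Nm → Ctx Tag → Prop) :
    ℕ → Proc Tag Nm → Ctx Tag → Prop
  | done (n) : TypingRule D X n .done Ctx.empty
  | link (n) {x y S T} : x ≠ y → Sub S.dual T →
      TypingRule D X (1 + n) (.link x y) ((Ctx.empty.ext x S).ext y T)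
  | call (m n) {A xs} {Γ : Ctx Tag} : xs.Nodup → xs.length = (D A).params.length →
      Γ.dom = {z | z ∈ xs} → X n (D.unfold A xs) Γ → TypingRule D X (m + n) (.call A xs) Γ
  | choiceL {m n P Q} {Γ : Ctx Tag} : X m P Γ → X n Q Γ → TypingRule D X (1 + m) (.choice P Q) Γ
  | choiceR {m n P Q} {Γ : Ctx Tag} : X m P Γ → X n Q Γ → TypingRule D X (1 + n) (.choice P Q) Γ
  | cut {m n x P Q S T} {Γ Δ : Ctx Tag} : Γ.Disjoint Δ → Γ x = none → Δ x = none → Correct S T →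
      X m P (Γ.ext x S) → X n Q (Δ.ext x T) →
      TypingRule D X (m + n) (.cut x P Q) (Γ.union Δ)
  | close (n) {x} : TypingRule D X (1 + n) (.close x) (Ctx.empty.ext x (.unit true))
  | wait {n x P} {Γ : Ctx Tag} : Γ x = none → X n P Γ →
      TypingRule D X n (.wait x P) (Γ.ext x (.unit false))
  | select {n x P I m S} {Γ : Ctx Tag} (k : {a // a ∈ I}) : Γ x = none → X n P (Γ.ext x (S k)) →
      TypingRule D X (1 + m k + n) (.select x k P) (Γ.ext x (.branch true I m S))
  /- The type may omit some tags `i` accepted by the process: their branches, which are never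
  selected, are only required to contain no other channels than the rest of the process. -/
  | case {n x} {Γ : Ctx Tag} {I J : Finset Tag} {m : {a // a ∈ J} → ℕ} {S : {a // a ∈ J} → Tree Tag}
      {P : {a // a ∈ I} → Proc Tag Nm} (hJ : J ⊆ I) : Γ x = none →
      (∀ j : {a // a ∈ J}, X (n + m j) (P ⟨j, hJ j.2⟩) (Γ.ext x (S j))) →
      (∀ i : {a // a ∈ I}, i.1 ∉ J → ∀ z ∈ (P i).fn, z = x ∨ z ∈ Γ.dom) →
      TypingRule D X n (.case x I P) (Γ.ext x (.branch false J m S))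
  | fork {m n x y P Q S T} {Γ Δ : Ctx Tag} : Γ.Disjoint Δ → Γ x = none → Δ x = none → Γ y = none →
      X m P (Γ.ext y T) → X n Q (Δ.ext x S) →
      TypingRule D X (1 + m + n) (.fork x y P Q) ((Γ.union Δ).ext x (.mult true T S))
  | join {n x y P S T} {Γ : Ctx Tag} : x ≠ y → Γ x = none → Γ y = none →
      X n P ((Γ.ext y T).ext x S) →
      TypingRule D X n (.join x y P) (Γ.ext x (.mult false T S))

/-- The typing judgement, the largest relation that is consistent with the typing rules
(derivations may be infinite) on processes up to renaming of bound channels and contexts of session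
types. -/
def Typed (D : Program Tag Nm) (n : ℕ) (P : Proc Tag Nm) (Γ : Ctx Tag) : Prop :=
  ∃ X : ℕ → Proc Tag Nm → Ctx Tag → Prop,
    (∀ n P Γ, X n P Γ →
      (∀ z S, Γ z = some S → S.Regular) ∧ ∃ P', AlphaEq P P' ∧ TypingRule D X n P' Γ) ∧
    X n P Γ

/-- `P` is well typed, in some finite context and with some measure. -/
def WellTyped (D : Program Tag Nm) (P : Proc Tag Nm) : Prop :=
  ∃ (n : ℕ) (Γ : Ctx Tag), Γ.dom.Finite ∧ Typed D n P Γ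

end CaP

/-!
Choice-free well-typed processes terminate because every reduction strictly decreases the measure of
a typing judgement. Typing as given is inconvenient for proving this: it is stated up to renaming of
bound channels, subtyping occurs at links only, and structural pre-congruence does not preserve the
splitting of contexts (a message whose process inputs from the empty choice `&{}` can be assigned a
channel that it does not contain). The proof therefore passes to *affine* typing, `Affine`, which is
preserved by everything.

* Subtyping is replaced by `Le S T`, the correct composition of `S` with the dual of `T`. On regular
  trees it contains subtyping, because a type composes correctly with its dual (`correct_dual`,
  `Le.of_sub`). It is a preorder compatible with composition, by the cut property `Correct.trans`: a
  correct composition of `S` and `T` and one of the dual of `T` and `U` can be chained. Regularity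
  plays no further role.
* Contexts become total functions, read at free channels only, and linearity becomes the disjointness
  of sets of free channels. Weakening and subsumption are then admissible, and the rules are directed
  by the syntax of the process, without renaming. That affine typing is nevertheless invariant under
  alpha-equivalence (`Affine.coinduct`) rests on the fact that `Proc.rename` composes up to syntactic
  equality (`Proc.rename_rename`), so that alpha-equivalent processes have equal images.
* A process that begins with a buffer is typed by typing the buffer and the rest separately
  (`affine_fill`). Inputs of the type of such a process commute with the buffer
  (`BufferTyped.trans_tag`, `BufferTyped.trans_chan`), which is what a communication needs. When
  outputs are moved across a link, the new types exist because a type that can perform an output late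
  is a supertype of the type that performs it at once (`Correct.outTag`, `Correct.mult`); these rest
  on the commutation of outputs with inputs of the same type (`Trans.diamond`).

Structural pre-congruence preserves affine typing with the same measure (`Str.affine`), and
reduction decreases the measure (`Red.affine`): the prefixes that disappear pay for the unit, and the
annotation of a selected tag is paid by the sender to the receiver.
-/

namespace CaP

/-! ### Session types as trees -/

section

variable {Tag Nm : Type}

namespace Tree

theorem cases_on (S : Tree Tag) : (∃ p, S = unit p) ∨ (∃ p T U, S = mult p T U) ∨
    ∃ p I m f, S = branch p I m f := by
  rcases h : S.dest with ⟨s, f⟩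
  have hS : S = PFunctor.M.mk (F := treeFunctor Tag) ⟨s, f⟩ := by rw [← h, PFunctor.M.mk_dest]
  cases s with
  | unit p =>
    refine Or.inl ⟨p, hS.trans ?_⟩
    have : f = fun i : Empty => i.elim := by funext i; exact Empty.elim i
    rw [this]; rfl
  | mult p =>
    refine Or.inr (Or.inl ⟨p, f true, f false, hS.trans ?_⟩)
    have : f = fun b : Bool => if b then f true else f false := by
      funext b; exact Bool.rec rfl rfl b
    conv_lhs => rw [this]
    rfl
  | branch p I m => exact Or.inr (Or.inr ⟨p, I, m, f, hS⟩)

theorem unit_inj {p q : Bool} (h : (unit p : Tree Tag) = unit q) : p = q := by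
  have := PFunctor.M.mk_inj h
  cases this
  rfl

theorem mult_inj {p q : Bool} {T U T' U' : Tree Tag} (h : mult p T U = mult q T' U') :
    p = q ∧ T = T' ∧ U = U' := by
  have h := PFunctor.M.mk_inj h
  obtain ⟨h₁, h₂⟩ := Sigma.mk.inj h
  cases h₁
  have h₂ := eq_of_heq h₂
  exact ⟨rfl, congrFun h₂ true, congrFun h₂ false⟩

theorem branch_inj {p q : Bool} {I J : Finset Tag} {m : {a // a ∈ I} → ℕ} {m' : {a // a ∈ J} → ℕ}
    {f : {a // a ∈ I} → Tree Tag} {f' : {a // a ∈ J} → Tree Tag}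
    (h : branch p I m f = branch q J m' f') : p = q ∧ ∃ e : I = J, e ▸ m = m' ∧ e ▸ f = f' := by
  have h := PFunctor.M.mk_inj h
  obtain ⟨h₁, h₂⟩ := Sigma.mk.inj h
  cases h₁
  exact ⟨rfl, rfl, rfl, eq_of_heq h₂⟩

theorem unit_ne_mult {p q : Bool} {T U : Tree Tag} : unit p ≠ mult q T U := by
  intro h
  have h := PFunctor.M.mk_inj h
  cases h

theorem unit_ne_branch {p q : Bool} {I m} {f : {a // a ∈ I} → Tree Tag} :
    unit p ≠ branch q I m f := by
  intro h
  have h := PFunctor.M.mk_inj h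
  cases h

theorem mult_ne_branch {p q : Bool} {T U : Tree Tag} {I m} {f : {a // a ∈ I} → Tree Tag} :
    mult p T U ≠ branch q I m f := by
  intro h
  have h := PFunctor.M.mk_inj h
  cases h

@[simp] theorem pol_unit (p) : (unit p : Tree Tag).pol = p := rfl
@[simp] theorem pol_mult (p) (T U : Tree Tag) : (mult p T U).pol = p := rfl
@[simp] theorem pol_branch (p I m) (f : {a // a ∈ I} → Tree Tag) : (branch p I m f).pol = p := rfl

theorem eq_of_dest_eq {S T : Tree Tag} (h : S.dest = T.dest) : S = T := by
  rw [← PFunctor.M.mk_dest S, ← PFunctor.M.mk_dest T, h]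

@[simp] theorem dual_unit (p) : (unit p : Tree Tag).dual = unit (!p) := by
  apply eq_of_dest_eq
  rw [dual, PFunctor.M.dest_corec]
  simp only [unit]
  refine Sigma.ext rfl (heq_of_eq ?_)
  funext i; exact Empty.elim i

@[simp] theorem dual_mult (p) (T U : Tree Tag) :
    (mult p T U).dual = mult (!p) T.dual U.dual := by
  apply eq_of_dest_eq
  rw [dual, PFunctor.M.dest_corec]
  simp only [mult]
  refine Sigma.ext rfl (heq_of_eq ?_)
  funext i
  cases (show Bool from i) <;> rfl

@[simp] theorem dual_branch (p I m) (f : {a // a ∈ I} → Tree Tag) :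
    (branch p I m f).dual = branch (!p) I m fun a => (f a).dual := by
  apply eq_of_dest_eq
  rw [dual, PFunctor.M.dest_corec]
  rfl

@[simp] theorem pol_dual (S : Tree Tag) : S.dual.pol = !S.pol := by
  rcases S.cases_on with ⟨p, rfl⟩ | ⟨p, T, U, rfl⟩ | ⟨p, I, m, f, rfl⟩ <;> simp

@[simp] theorem dual_dual (S : Tree Tag) : S.dual.dual = S := by
  refine PFunctor.M.bisim (P := treeFunctor Tag) (fun A B => A = Tree.dual (Tree.dual B)) ?_ _ _ rfl
  rintro _ B rfl
  rcases Tree.cases_on B with ⟨p, rfl⟩ | ⟨p, T, U, rfl⟩ | ⟨p, I, m, f, rfl⟩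
  · refine ⟨Shape.unit p, fun i : Empty => i.elim, fun i : Empty => i.elim, ?_, rfl,
      fun i => Empty.elim i⟩
    exact (congrArg PFunctor.M.dest (show (unit p).dual.dual = unit p by simp)).trans rfl
  · refine ⟨Shape.mult p, fun b : Bool => if b then T.dual.dual else U.dual.dual,
      fun b : Bool => if b then T else U, ?_, rfl, ?_⟩
    · exact (congrArg PFunctor.M.dest
        (show (mult p T U).dual.dual = mult p T.dual.dual U.dual.dual by simp)).trans rfl
    · intro i
      cases (show Bool from i) <;> rfl
  · refine ⟨Shape.branch p I m, fun a => (f a).dual.dual, f, ?_, rfl, fun i => rfl⟩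
    exact (congrArg PFunctor.M.dest
      (show (branch p I m f).dual.dual = branch p I m fun a => (f a).dual.dual by simp)).trans rfl

/-- The subtrees of `S.dual` are the duals of the subtrees of `S`. -/
theorem Regular.dual {S : Tree Tag} (h : S.Regular) : S.dual.Regular := by
  refine (h.image Tree.dual).subset ?_
  suffices ∀ T U : Tree Tag, Subtree T U → ∀ S : Tree Tag, U = S.dual → Subtree T.dual S from
    fun T hT => ⟨T.dual, this _ _ hT S rfl, T.dual_dual⟩
  intro T U hTU
  induction hTU with
  | refl => rintro S rfl; rw [dual_dual]; exact .refl S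
  | child i h ih =>
    rintro S hS
    rcases S.cases_on with ⟨p, rfl⟩ | ⟨p, V, W, rfl⟩ | ⟨p, I, m, f, rfl⟩
    · rw [dual_unit] at hS; subst hS
      exact Empty.elim i
    · rw [dual_mult] at hS; subst hS
      refine Subtree.child (S := mult p V W) (show Bool from i) (ih _ ?_)
      cases (show Bool from i) <;> rfl
    · rw [dual_branch] at hS; subst hS
      exact Subtree.child (S := Tree.branch p I m f) (show {a // a ∈ I} from i) (ih _ rfl)

end Tree

end

/-! ### Asynchronous transitions -/

section

variable {Tag Nm : Type}

section Transitions

open CaP.Tree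

variable {X Y : Tree Tag → Bool → Obj Tag → Tree Tag → Prop} {S T U : Tree Tag} {p q : Bool}
  {σ : Obj Tag}

theorem LRule.mono (h : ∀ S p σ T, X S p σ T → Y S p σ T) (hX : LRule X S p σ T) :
    LRule Y S p σ T := by
  cases hX with
  | mustUnit => exact .mustUnit _
  | mustMult => exact .mustMult _ _ _
  | mustBranch => exact .mustBranch ..
  | mayMult hX => exact .mayMult (h _ _ _ _ hX)
  | mayBranch hX => exact .mayBranch fun a => h _ _ _ _ (hX a)

theorem Trans.unfold (h : Trans S p σ T) : LRule Trans S p σ T ∧ IndTrans S p σ T := by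
  obtain ⟨X, hX, h⟩ := h
  exact ⟨(hX _ _ _ _ h).1.mono fun S p σ T h => ⟨X, hX, h⟩, (hX _ _ _ _ h).2⟩

theorem Trans.fold (h : LRule Trans S p σ T) (h' : IndTrans S p σ T) : Trans S p σ T :=
  ⟨fun S p σ T => LRule Trans S p σ T ∧ IndTrans S p σ T,
    fun _ _ _ _ h => ⟨h.1.mono fun _ _ _ _ h => h.unfold, h.2⟩, h, h'⟩

theorem Trans.mustUnit (p) : Trans (unit p : Tree Tag) p .star (unit p) :=
  .fold (.mustUnit _) (.mustUnit _)

theorem Trans.mustMult (p) (T S : Tree Tag) : Trans (mult p T S) p (.chan T) S :=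
  .fold (.mustMult ..) (.mustMult ..)

theorem Trans.mustBranch (p) {I : Finset Tag} (m) (S : {a // a ∈ I} → Tree Tag)
    (k : {a // a ∈ I}) :
    Trans (branch p I m S) p (.tag k (m k)) (S k) :=
  .fold (.mustBranch ..) (.mustBranch ..)

theorem Trans.mayMult (h : Trans S (!p) σ U) : Trans (mult p T S) (!p) σ (mult p T U) :=
  .fold (.mayMult h) (.mayMult h.unfold.2)

theorem Trans.mayBranch {I : Finset Tag} {m} {S U : {a // a ∈ I} → Tree Tag}
    (h : ∀ a, Trans (S a) (!p) σ (U a)) : Trans (branch p I m S) (!p) σ (branch p I m U) :=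
  .fold (.mayBranch h) (.mayBranch fun a => (h a).unfold.2)

theorem Trans.unit_inv (h : Trans (unit p) q σ T) : q = p ∧ σ = .star ∧ T = unit p := by
  generalize hS : unit p = S at h
  cases h.unfold.1 with
  | mustUnit => cases unit_inj hS; exact ⟨rfl, rfl, rfl⟩
  | mustMult => exact absurd hS unit_ne_mult
  | mustBranch => exact absurd hS unit_ne_branch
  | mayMult => exact absurd hS unit_ne_mult
  | mayBranch => exact absurd hS unit_ne_branch

theorem Trans.mult_inv_must {V : Tree Tag} (h : Trans (mult p T S) p σ V) :
    σ = .chan T ∧ V = S := by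
  generalize hS : mult p T S = S' at h
  generalize hp : p = p' at h
  cases h.unfold.1 with
  | mustUnit => exact absurd hS.symm unit_ne_mult
  | mustMult => obtain ⟨-, rfl, rfl⟩ := mult_inj hS; exact ⟨rfl, rfl⟩
  | mustBranch => exact absurd hS mult_ne_branch
  | mayMult => obtain ⟨rfl, rfl, rfl⟩ := mult_inj hS; simp at hp
  | mayBranch => exact absurd hS mult_ne_branch

theorem Trans.mult_inv_may {V : Tree Tag} (h : Trans (mult p T S) (!p) σ V) :
    ∃ U, Trans S (!p) σ U ∧ V = mult p T U := by
  generalize hS : mult p T S = S' at h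
  generalize hp : (!p) = p' at h
  cases h.unfold.1 with
  | mustUnit => exact absurd hS.symm unit_ne_mult
  | mustMult => obtain ⟨rfl, rfl, rfl⟩ := mult_inj hS; simp at hp
  | mustBranch => exact absurd hS mult_ne_branch
  | mayMult h' => obtain ⟨rfl, rfl, rfl⟩ := mult_inj hS; exact ⟨_, h', rfl⟩
  | mayBranch => exact absurd hS mult_ne_branch

theorem Trans.branch_inv_must {I : Finset Tag} {m} {f : {a // a ∈ I} → Tree Tag}
    (h : Trans (branch p I m f) p σ T) : ∃ k : {a // a ∈ I}, σ = .tag k (m k) ∧ T = f k := by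
  generalize hS : branch p I m f = S' at h
  generalize hp : p = p' at h
  cases h.unfold.1 with
  | mustUnit => exact absurd hS.symm unit_ne_branch
  | mustMult => exact absurd hS.symm mult_ne_branch
  | mustBranch => obtain ⟨-, rfl, rfl, rfl⟩ := branch_inj hS; exact ⟨_, rfl, rfl⟩
  | mayMult => exact absurd hS.symm mult_ne_branch
  | mayBranch => obtain ⟨rfl, -⟩ := branch_inj hS; simp at hp

theorem Trans.branch_inv_may {I : Finset Tag} {m} {f : {a // a ∈ I} → Tree Tag}
    (h : Trans (branch p I m f) (!p) σ T) :
    ∃ g, (∀ a, Trans (f a) (!p) σ (g a)) ∧ T = branch p I m g := by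
  generalize hS : branch p I m f = S' at h
  generalize hp : (!p) = p' at h
  cases h.unfold.1 with
  | mustUnit => exact absurd hS.symm unit_ne_branch
  | mustMult => exact absurd hS.symm mult_ne_branch
  | mustBranch => obtain ⟨rfl, -⟩ := branch_inj hS; simp at hp
  | mayMult => exact absurd hS.symm mult_ne_branch
  | mayBranch h' => obtain ⟨rfl, rfl, rfl, rfl⟩ := branch_inj hS; exact ⟨_, h', rfl⟩

/-- An output and an input of the same type commute: one of them is immediate, and the other one
takes place underneath it. -/
theorem Trans.diamond {τ : Obj Tag} (h₁ : Trans S p σ T) (h₂ : Trans S (!p) τ U) :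
    ∃ V, Trans T (!p) τ V ∧ Trans U p σ V := by
  suffices key : ∀ {p σ τ T U}, S.pol = p → Trans S p σ T → Trans S (!p) τ U →
      ∃ V, Trans T (!p) τ V ∧ Trans U p σ V by
    by_cases hp : S.pol = p
    · exact key hp h₁ h₂
    · have hp : S.pol = !p := by cases h : S.pol <;> cases p <;> simp_all
      obtain ⟨V, h, h'⟩ := key (T := U) (U := T) hp h₂ (by simpa using h₁)
      exact ⟨V, h', by simpa using h⟩
  rintro p σ τ T U rfl h₁ h₂
  rcases S.cases_on with ⟨p, rfl⟩ | ⟨p, V, W, rfl⟩ | ⟨p, I, m, f, rfl⟩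
  · have := h₂.unit_inv.1
    simp at this
  · obtain ⟨rfl, rfl⟩ := h₁.mult_inv_must
    obtain ⟨U, h, rfl⟩ := h₂.mult_inv_may
    exact ⟨U, h, .mustMult ..⟩
  · obtain ⟨k, rfl, rfl⟩ := h₁.branch_inv_must
    obtain ⟨g, h, rfl⟩ := h₂.branch_inv_may
    exact ⟨g k, h k, .mustBranch _ m g k⟩

/-- Duality of labels. -/
def Obj.dual : Obj Tag → Obj Tag
  | .chan T => .chan T.dual
  | σ => σ

@[simp] theorem Obj.dual_star : (.star : Obj Tag).dual = .star := rfl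
@[simp] theorem Obj.dual_tag (a : Tag) (m : ℕ) : (Obj.tag a m).dual = .tag a m := rfl
@[simp] theorem Obj.dual_chan (T : Tree Tag) : (Obj.chan T).dual = .chan T.dual := rfl

@[simp] theorem Obj.dual_dual (σ : Obj Tag) : σ.dual.dual = σ := by
  cases σ <;> simp

theorem IndTrans.dual (h : IndTrans S p σ T) : IndTrans S.dual (!p) σ.dual T.dual := by
  induction h with
  | mustUnit => simpa using IndTrans.mustUnit _
  | mustMult => simpa using IndTrans.mustMult ..
  | mustBranch p I m S k => simpa using IndTrans.mustBranch _ _ _ (fun a => (S a).dual) k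
  | mayMult _ ih => simpa using IndTrans.mayMult ih
  | mayBranch _ ih => simpa using IndTrans.mayBranch ih
  | @fair p I m σ S S' k _ ih =>
    simpa using IndTrans.fair (m := m) (S := fun a => (S a).dual) (S' := fun a => (S' a).dual) k ih

theorem LRule.dual (h : LRule X S p σ T) :
    LRule (fun S p σ T => X S.dual (!p) σ.dual T.dual) S.dual (!p) σ.dual T.dual := by
  cases h with
  | mustUnit => simpa using LRule.mustUnit _
  | mustMult => simpa using LRule.mustMult ..
  | mustBranch p I m S k => simpa using LRule.mustBranch _ _ _ (fun a => (S a).dual) k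
  | mayMult h =>
    rw [dual_mult, dual_mult]
    exact .mayMult (by simpa using h)
  | mayBranch h =>
    rw [dual_branch, dual_branch]
    exact .mayBranch fun a => by simpa using h a

theorem Trans.dual (h : Trans S p σ T) : Trans S.dual (!p) σ.dual T.dual := by
  refine ⟨fun S p σ T => Trans S.dual (!p) σ.dual T.dual, ?_, by simpa using h⟩
  intro S p σ T h
  have h₁ := h.unfold.1.dual
  have h₂ := h.unfold.2.dual
  simp only [Tree.dual_dual, Bool.not_not, Obj.dual_dual] at h₁ h₂
  exact ⟨h₁, h₂⟩

end Transitions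

/-! ### Correct composition -/

section Composition

variable {S T U V : Tree Tag}

theorem isCorrectComp_correct : IsCorrectComp (Correct : Tree Tag → Tree Tag → Prop) where
  pp := fun S T ⟨_, hR, h⟩ => hR.pp S T h
  io := fun S T ⟨R, hR, h⟩ σ T' hσ ht =>
    let ⟨S', hs, h'⟩ := hR.io S T h σ T' hσ ht
    ⟨S', hs, R, hR, h'⟩
  oi := fun S T ⟨R, hR, h⟩ σ T' hσ ht =>
    let ⟨S', hs, h'⟩ := hR.oi S T h σ T' hσ ht
    ⟨S', hs, R, hR, h'⟩
  ios := fun S T ⟨R, hR, h⟩ T₁ T₂ ht =>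
    let ⟨S₁, S₂, hs, h₁, h₂⟩ := hR.ios S T h T₁ T₂ ht
    ⟨S₁, S₂, hs, ⟨R, hR, h₁⟩, ⟨R, hR, h₂⟩⟩
  ois := fun S T ⟨R, hR, h⟩ T₁ T₂ ht =>
    let ⟨S₁, S₂, hs, h₁, h₂⟩ := hR.ois S T h T₁ T₂ ht
    ⟨S₁, S₂, hs, ⟨R, hR, h₁⟩, ⟨R, hR, h₂⟩⟩

theorem Correct.symm (h : Correct S T) : Correct T S := by
  obtain ⟨R, hR, h⟩ := h
  refine ⟨fun S T => R T S, ⟨fun S T h => (hR.pp T S h).symm, fun S T h => hR.oi T S h,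
    fun S T h => hR.io T S h, fun S T h T₁ T₂ ht => ?_, fun S T h T₁ T₂ ht => ?_⟩, h⟩
  · exact hR.ois T S h T₁ T₂ ht
  · exact hR.ios T S h T₁ T₂ ht

/-- For a symmetric relation, half of the conditions suffice. -/
theorem IsCorrectComp.of_symm {R : Tree Tag → Tree Tag → Prop} (hs : ∀ S T, R S T → R T S)
    (pp : ∀ S T, R S T → S.pol = true ∨ T.pol = true)
    (io : ∀ S T, R S T → ∀ σ T', (∀ U, σ ≠ .chan U) → Trans T true σ T' →
      ∃ S', Trans S false σ S' ∧ R S' T')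
    (ios : ∀ S T, R S T → ∀ T₁ T₂, Trans T true (.chan T₁) T₂ →
      ∃ S₁ S₂, Trans S false (.chan S₁) S₂ ∧ R S₁ T₁ ∧ R S₂ T₂) : IsCorrectComp R where
  pp := pp
  io := io
  ios := ios
  oi := fun S T h σ S' hσ ht =>
    let ⟨T', h₁, h₂⟩ := io T S (hs S T h) σ S' hσ ht
    ⟨T', h₁, hs _ _ h₂⟩
  ois := fun S T h S₁ S₂ ht =>
    let ⟨T₁, T₂, h₁, h₂, h₃⟩ := ios T S (hs S T h) S₁ S₂ ht
    ⟨T₁, T₂, h₁, hs _ _ h₂, hs _ _ h₃⟩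

theorem Obj.dual_eq_of_ne_chan {σ : Obj Tag} (h : ∀ U, σ ≠ .chan U) : σ.dual = σ := by
  cases σ with
  | chan T => exact absurd rfl (h T)
  | _ => rfl

theorem correct_dual (S : Tree Tag) : Correct S S.dual := by
  refine ⟨fun S T => T = S.dual, .of_symm ?_ ?_ ?_ ?_, rfl⟩
  · rintro S _ rfl; simp
  · rintro S _ rfl
    cases h : S.pol <;> simp [h]
  · rintro S _ rfl σ T' hσ h
    have := h.dual
    rw [Tree.dual_dual, Obj.dual_eq_of_ne_chan hσ] at this
    exact ⟨_, this, by simp⟩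
  · rintro S _ rfl T₁ T₂ h
    have := h.dual
    rw [Tree.dual_dual] at this
    exact ⟨_, _, this, by simp, by simp⟩

/-- The cut property of correct composition, from which subtyping is a preorder that is compatible
with composition. -/
theorem Correct.trans (h₁ : Correct S T) (h₂ : Correct T.dual U) : Correct S U := by
  have hC := isCorrectComp_correct (Tag := Tag)
  refine ⟨fun S U => ∃ T, Correct S T ∧ Correct T.dual U, .of_symm ?_ ?_ ?_ ?_, T, h₁, h₂⟩
  · rintro S U ⟨T, h₁, h₂⟩
    exact ⟨T.dual, h₂.symm, by simpa using h₁.symm⟩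
  · rintro S U ⟨T, h₁, h₂⟩
    have h₁ := hC.pp _ _ h₁
    have h₂ := hC.pp _ _ h₂
    rw [Tree.pol_dual] at h₂
    cases hT : T.pol <;> simp_all
  · rintro S U ⟨T, h₁, h₂⟩ σ U' hσ h
    obtain ⟨V, hV, h₂⟩ := hC.io _ _ h₂ σ U' hσ h
    have hV := hV.dual
    rw [Tree.dual_dual, Obj.dual_eq_of_ne_chan hσ] at hV
    obtain ⟨S', hS, h₁⟩ := hC.io _ _ h₁ σ _ hσ hV
    exact ⟨S', hS, _, h₁, by simpa using h₂⟩
  · rintro S U ⟨T, h₁, h₂⟩ U₁ U₂ h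
    obtain ⟨V₁, V₂, hV, h₃, h₄⟩ := hC.ios _ _ h₂ U₁ U₂ h
    have hV := hV.dual
    rw [Tree.dual_dual] at hV
    obtain ⟨S₁, S₂, hS, h₅, h₆⟩ := hC.ios _ _ h₁ _ _ hV
    exact ⟨S₁, S₂, hS, ⟨_, h₅, by simpa using h₃⟩, ⟨_, h₆, by simpa using h₄⟩⟩

/-- Subtyping, expressed by composition with the dual of the larger type: this form needs no
quantification over regular types, and it makes sense for all trees. -/
def Le (S T : Tree Tag) : Prop := Correct S T.dual

theorem Le.refl (S : Tree Tag) : Le S S := correct_dual S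

theorem Le.trans (h₁ : Le S T) (h₂ : Le T U) : Le S U :=
  Correct.trans h₁ (by rw [Tree.dual_dual]; exact h₂)

theorem Le.correct (h : Le S T) (h' : Correct T U) : Correct S U :=
  Correct.trans h (by rwa [Tree.dual_dual])

theorem Correct.le_dual (h : Correct S T) : Le S T.dual := by
  rwa [Le, Tree.dual_dual]

theorem Le.dual (h : Le S T) : Le T.dual S.dual := by
  rw [Le, Tree.dual_dual]; exact Correct.symm h

theorem Le.of_sub (h : Sub S T) (hT : T.Regular) : Le S T :=
  (h _ hT.dual (correct_dual T).symm).symm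

/-- A subtype simulates the inputs of tags. -/
theorem Le.trans_tag (h : Le S T) {a : Tag} {m : ℕ} {T' : Tree Tag}
    (hT : Trans T false (.tag a m) T') : ∃ S', Trans S false (.tag a m) S' ∧ Le S' T' :=
  isCorrectComp_correct.io _ _ h _ _ (by simp) hT.dual

/-- A subtype simulates the inputs of channels. -/
theorem Le.trans_chan (h : Le S T) {T₁ T₂ : Tree Tag} (hT : Trans T false (.chan T₁) T₂) :
    ∃ S₁ S₂, Trans S false (.chan S₁) S₂ ∧ Le S₁ T₁ ∧ Le S₂ T₂ :=
  isCorrectComp_correct.ios _ _ h _ _ hT.dual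

/-- The type of the output of the tag `a`, of annotation `m`. -/
def Tree.outTag (a : Tag) (m : ℕ) (S : Tree Tag) : Tree Tag :=
  .branch true {a} (fun _ => m) fun _ => S

theorem Tree.trans_outTag (a : Tag) (m : ℕ) (S : Tree Tag) :
    Trans (outTag a m S) true (.tag a m) S :=
  .mustBranch true (I := {a}) (fun _ => m) (fun _ => S) ⟨a, by simp⟩

theorem Trans.outTag_inv {a : Tag} {m : ℕ} {σ : Obj Tag}
    (h : Trans (Tree.outTag a m S) false σ T) :
    ∃ S', Trans S false σ S' ∧ T = Tree.outTag a m S' := by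
  obtain ⟨g, hg, rfl⟩ := Trans.branch_inv_may (p := true) h
  refine ⟨g ⟨a, by simp⟩, hg _, ?_⟩
  unfold Tree.outTag
  congr 1
  funext ⟨b, hb⟩
  obtain rfl : b = a := by simpa using hb
  rfl

/-- A type that can input a tag composes with the type that begins with the output of that tag. -/
theorem Correct.outTag {a : Tag} {m : ℕ} (h : Trans S false (.tag a m) U) (h' : Correct U V) :
    Correct S (.outTag a m V) := by
  have hC := isCorrectComp_correct (Tag := Tag)
  refine ⟨fun S T => Correct S T ∨ ∃ U V, T = .outTag a m V ∧ Trans S false (.tag a m) U ∧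
    Correct U V, ⟨?_, ?_, ?_, ?_, ?_⟩, Or.inr ⟨U, V, rfl, h, h'⟩⟩
  · rintro S _ (h | ⟨U, V, rfl, h, h'⟩)
    · exact hC.pp _ _ h
    · exact Or.inr rfl
  · rintro S _ (h | ⟨U, V, rfl, h, h'⟩) σ T' hσ ht
    · obtain ⟨S', hS, h'⟩ := hC.io _ _ h σ T' hσ ht
      exact ⟨S', hS, Or.inl h'⟩
    · obtain ⟨⟨k, hk⟩, rfl, rfl⟩ := Trans.branch_inv_must ht
      obtain rfl : k = a := by simpa using hk
      exact ⟨U, h, Or.inl h'⟩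
  · rintro S _ (h | ⟨U, V, rfl, h, h'⟩) σ S' hσ ht
    · obtain ⟨T', hT, h'⟩ := hC.oi _ _ h σ S' hσ ht
      exact ⟨T', hT, Or.inl h'⟩
    · obtain ⟨W, hW, hU⟩ := Trans.diamond (p := true) ht h
      obtain ⟨V', hV, hW'⟩ := hC.oi _ _ h' σ W hσ hU
      exact ⟨_, Trans.mayBranch (p := true) fun _ => hV, Or.inr ⟨W, V', rfl, hW, hW'⟩⟩
  · rintro S _ (h | ⟨U, V, rfl, h, h'⟩) T₁ T₂ ht
    · obtain ⟨S₁, S₂, hS, h₁, h₂⟩ := hC.ios _ _ h T₁ T₂ ht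
      exact ⟨S₁, S₂, hS, Or.inl h₁, Or.inl h₂⟩
    · obtain ⟨k, hk, -⟩ := Trans.branch_inv_must ht
      cases hk
  · rintro S _ (h | ⟨U, V, rfl, h, h'⟩) S₁ S₂ ht
    · obtain ⟨T₁, T₂, hT, h₁, h₂⟩ := hC.ois _ _ h S₁ S₂ ht
      exact ⟨T₁, T₂, hT, Or.inl h₁, Or.inl h₂⟩
    · obtain ⟨W, hW, hU⟩ := Trans.diamond (p := true) ht h
      obtain ⟨V₁, V₂, hV, h₁, h₂⟩ := hC.ois _ _ h' S₁ W hU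
      exact ⟨_, _, Trans.mayBranch (p := true) fun _ => hV, Or.inl h₁,
        Or.inr ⟨W, V₂, rfl, hW, h₂⟩⟩

/-- A type that can input a channel composes with the type that begins with the output of a channel
of a matching type. -/
theorem Correct.mult {S₁ S₂ T₁ T₂ : Tree Tag} (h : Trans S false (.chan S₁) S₂)
    (h₁ : Correct S₁ T₁) (h₂ : Correct S₂ T₂) : Correct S (.mult true T₁ T₂) := by
  have hC := isCorrectComp_correct (Tag := Tag)
  refine ⟨fun S T => Correct S T ∨ ∃ S₂ T₂, T = .mult true T₁ T₂ ∧ Trans S false (.chan S₁) S₂ ∧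
    Correct S₂ T₂, ⟨?_, ?_, ?_, ?_, ?_⟩, Or.inr ⟨S₂, T₂, rfl, h, h₂⟩⟩
  · rintro S _ (h | ⟨U, V, rfl, h, h'⟩)
    · exact hC.pp _ _ h
    · exact Or.inr rfl
  · rintro S _ (h | ⟨U, V, rfl, h, h'⟩) σ T' hσ ht
    · obtain ⟨S', hS, h'⟩ := hC.io _ _ h σ T' hσ ht
      exact ⟨S', hS, Or.inl h'⟩
    · exact absurd (Trans.mult_inv_must ht).1 (hσ _)
  · rintro S _ (h | ⟨U, V, rfl, h, h'⟩) σ S' hσ ht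
    · obtain ⟨T', hT, h'⟩ := hC.oi _ _ h σ S' hσ ht
      exact ⟨T', hT, Or.inl h'⟩
    · obtain ⟨W, hW, hU⟩ := Trans.diamond (p := true) ht h
      obtain ⟨V', hV, hW'⟩ := hC.oi _ _ h' σ W hσ hU
      exact ⟨_, Trans.mayMult (p := true) hV, Or.inr ⟨W, V', rfl, hW, hW'⟩⟩
  · rintro S _ (h | ⟨U, V, rfl, h, h'⟩) U₁ U₂ ht
    · obtain ⟨S₁, S₂, hS, h₁, h₂⟩ := hC.ios _ _ h U₁ U₂ ht
      exact ⟨S₁, S₂, hS, Or.inl h₁, Or.inl h₂⟩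
    · obtain ⟨e, rfl⟩ := Trans.mult_inv_must ht
      cases e
      exact ⟨_, _, h, Or.inl h₁, Or.inl h'⟩
  · rintro S _ (h | ⟨U, V, rfl, h, h'⟩) U₁ U₂ ht
    · obtain ⟨T₁, T₂, hT, h₁, h₂⟩ := hC.ois _ _ h U₁ U₂ ht
      exact ⟨T₁, T₂, hT, Or.inl h₁, Or.inl h₂⟩
    · obtain ⟨W, hW, hU⟩ := Trans.diamond (p := true) ht h
      obtain ⟨V₁, V₂, hV, h₁, h₂⟩ := hC.ois _ _ h' U₁ W hU
      exact ⟨_, _, Trans.mayMult (p := true) hV, Or.inl h₁, Or.inr ⟨W, V₂, rfl, hW, h₂⟩⟩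

/-- An output may be anticipated. -/
theorem Le.outTag {a : Tag} {m : ℕ} (h : Trans S true (.tag a m) T) : Le (.outTag a m T) S :=
  Correct.symm (Correct.outTag h.dual (correct_dual T).symm)

end Composition

end

/-! ### Renaming and alpha-equivalence -/

section

variable {Tag Nm : Type}

theorem fresh_notMem (s : Finset Chan) : fresh s ∉ s := by
  intro h
  have : fresh s ≤ s.sup id := Finset.le_sup (f := id) h
  exact absurd this (Nat.not_succ_le_self _)

section Binders

variable {ρ σ : Chan → Chan} {s : Finset Chan} {y z : Chan}

theorem image_update (h : z ∉ (s.erase y).image ρ) :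
    (s.image (Function.update ρ y z)).erase z = (s.erase y).image ρ := by
  ext w
  simp only [Finset.mem_erase, Finset.mem_image, Function.update_apply] at h ⊢
  constructor
  · rintro ⟨hw, a, ha, rfl⟩
    by_cases hay : a = y
    · simp [hay] at hw
    · exact ⟨a, ⟨hay, ha⟩, by simp [hay]⟩
  · rintro ⟨a, ⟨hay, ha⟩, rfl⟩
    exact ⟨fun e => h ⟨a, ⟨hay, ha⟩, e⟩, a, ha, by simp [hay]⟩

theorem injOn_update (h : z ∉ (s.erase y).image ρ) (hρ : Set.InjOn ρ (s.erase y)) :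
    Set.InjOn (Function.update ρ y z) s := by
  intro a ha b hb hab
  simp only [Finset.mem_image, Finset.mem_erase, Function.update_apply, not_exists, not_and,
    and_imp] at h hab
  by_cases hay : a = y <;> by_cases hby : b = y <;> simp only [hay, hby, if_true, if_false] at hab
  · rw [hay, hby]
  · exact absurd hab.symm (h b hby hb)
  · exact absurd hab (h a hay ha)
  · exact hρ (by simpa [hay] using ha) (by simpa [hby] using hb) hab

end Binders

namespace Proc

theorem rename_congr {P : Proc Tag Nm} {ρ σ : Chan → Chan} (h : ∀ z ∈ P.fn, ρ z = σ z) :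
    P.rename ρ = P.rename σ := by
  have upd : ∀ {s : Finset Chan} {ρ σ : Chan → Chan} {y : Chan} (w : Chan),
      (∀ z ∈ s.erase y, ρ z = σ z) → ∀ z ∈ s, Function.update ρ y w z = Function.update σ y w z := by
    intro s ρ σ y w h z hz
    by_cases hzy : z = y
    · simp [hzy]
    · simpa [hzy] using h z (Finset.mem_erase.2 ⟨hzy, hz⟩)
  induction P generalizing ρ σ with
  | link x y => simp [rename, h x (by simp [fn]), h y (by simp [fn])]
  | close x => simp [rename, h x (by simp [fn])]
  | select x a P ih =>
    rw [rename, rename, h x (by simp [fn]), ih fun z hz => h z (by simp [fn, hz])]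
  | fork x y P Q ihP ihQ =>
    have e : ∀ z ∈ P.fn.erase y, ρ z = σ z := fun z hz => h z (by
      simp only [fn, Finset.mem_insert, Finset.mem_union]; exact Or.inr (Or.inl hz))
    rw [rename, rename, h x (by simp [fn]), ihQ fun z hz => h z (by simp [fn, hz]),
      Finset.image_congr fun z hz => e z hz,
      ihP (upd _ e)]
  | choice P Q ihP ihQ =>
    rw [rename, rename, ihP fun z hz => h z (by simp [fn, hz]),
      ihQ fun z hz => h z (by simp [fn, hz])]
  | done => rfl
  | call A xs =>
    rw [rename, rename]
    congr 1
    exact List.map_congr_left fun z hz => h z (by simpa [fn] using hz)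
  | wait x P ih =>
    rw [rename, rename, h x (by simp [fn]), ih fun z hz => h z (by simp [fn, hz])]
  | case x I P ih =>
    rw [rename, rename, h x (by simp [fn])]
    congr 1
    funext a
    exact ih a fun z hz => h z (by
      simp only [fn, Finset.mem_insert, Finset.mem_biUnion]
      exact Or.inr ⟨a, Finset.mem_attach _ _, hz⟩)
  | join x y P ih =>
    have e : ∀ z ∈ P.fn.erase y, ρ z = σ z := fun z hz => h z (by
      simp only [fn, Finset.mem_insert]; exact Or.inr hz)
    rw [rename, rename, h x (by simp [fn]), Finset.image_congr fun z hz => e z hz,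
      ih (upd _ e)]
  | cut x P Q ihP ihQ =>
    have e : ∀ z ∈ (P.fn ∪ Q.fn).erase x, ρ z = σ z := h
    rw [rename, rename, Finset.image_congr fun z hz => e z hz,
      ihP fun z hz => upd _ e z (Finset.mem_union_left _ hz),
      ihQ fun z hz => upd _ e z (Finset.mem_union_right _ hz)]

theorem fn_rename (P : Proc Tag Nm) (ρ : Chan → Chan) : (P.rename ρ).fn = P.fn.image ρ := by
  induction P generalizing ρ with
  | link x y => simp [rename, fn, Finset.image_insert]
  | close x => simp [rename, fn]
  | select x a P ih => simp [rename, fn, ih, Finset.image_insert]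
  | fork x y P Q ihP ihQ =>
    simp only [rename, fn, ihP, ihQ, image_update (fresh_notMem _), Finset.image_insert,
      Finset.image_union]
  | choice P Q ihP ihQ => simp [rename, fn, ihP, ihQ, Finset.image_union]
  | done => simp [rename, fn]
  | call A xs =>
    ext z
    simp [rename, fn]
  | wait x P ih => simp [rename, fn, ih, Finset.image_insert]
  | case x I P ih => simp [rename, fn, ih, Finset.image_insert, Finset.biUnion_image]
  | join x y P ih =>
    simp only [rename, fn, ih, image_update (fresh_notMem _), Finset.image_insert]
  | cut x P Q ihP ihQ =>
    simp only [rename, fn, ihP, ihQ, ← Finset.image_union, image_update (fresh_notMem _)]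

/-- Renamings compose up to syntactic equality, because the channel chosen for a binder depends only
on the image of the free channels. -/
theorem rename_rename (P : Proc Tag Nm) (ρ σ : Chan → Chan) :
    (P.rename σ).rename ρ = P.rename (ρ ∘ σ) := by
  have upd : ∀ {s : Finset Chan} {ρ σ : Chan → Chan} {y z : Chan} (w : Chan),
      z ∉ (s.erase y).image σ → ∀ a ∈ s,
        (Function.update ρ z w ∘ Function.update σ y z) a = Function.update (ρ ∘ σ) y w a := by
    intro s ρ σ y z w hz a ha
    by_cases hay : a = y
    · simp [hay]
    · have : σ a ≠ z := fun e =>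
        hz (Finset.mem_image.2 ⟨a, Finset.mem_erase.2 ⟨hay, ha⟩, e⟩)
      simp [hay, this]
  induction P generalizing ρ σ with
  | link x y => rfl
  | close x => rfl
  | select x a P ih => simp [rename, ih]
  | fork x y P Q ihP ihQ =>
    simp only [rename, ihP, ihQ, fn_rename, image_update (fresh_notMem _), Finset.image_image,
      Function.comp_apply]
    rw [rename_congr (upd _ (fresh_notMem _))]
  | choice P Q ihP ihQ => simp [rename, ihP, ihQ]
  | done => rfl
  | call A xs => simp [rename]
  | wait x P ih => simp [rename, ih]
  | case x I P ih => simp [rename, ih]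
  | join x y P ih =>
    simp only [rename, ih, fn_rename, image_update (fresh_notMem _), Finset.image_image,
      Function.comp_apply]
    rw [rename_congr (upd _ (fresh_notMem _))]
  | cut x P Q ihP ihQ =>
    simp only [rename, ihP, ihQ, fn_rename, ← Finset.image_union, image_update (fresh_notMem _),
      Finset.image_image]
    rw [rename_congr fun a ha => upd _ (fresh_notMem _) a (Finset.mem_union_left Q.fn ha),
      rename_congr fun a ha => upd _ (fresh_notMem _) a (Finset.mem_union_right P.fn ha)]

end Proc

theorem rename_comp_update {s : Finset Chan} {ρ : Chan → Chan} {y z w : Chan} (hz : z ∉ s) :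
    ∀ a ∈ s, (Function.update ρ z w ∘ Function.update id y z) a = Function.update ρ y w a := by
  intro a ha
  by_cases hay : a = y
  · simp [hay]
  · have : a ≠ z := by rintro rfl; exact hz ha
    simp [hay, this]

theorem image_rename_erase {s : Finset Chan} {y z : Chan} (hz : z ∉ s) :
    (s.image (Function.update id y z)).erase z = s.erase y := by
  have h := image_update (ρ := id) (s := s) (y := y) (z := z) (by simp [hz])
  rwa [Finset.image_id] at h

theorem AlphaStep.rename_eq {P Q : Proc Tag Nm} (h : AlphaStep P Q) (ρ : Chan → Chan) :
    P.rename ρ = Q.rename ρ := by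
  cases h with
  | fork hz =>
    simp only [Proc.rename, Proc.subst, Proc.fn_rename, Proc.rename_rename, image_rename_erase hz]
    rw [Proc.rename_congr (rename_comp_update hz)]
  | join hz =>
    simp only [Proc.rename, Proc.subst, Proc.fn_rename, Proc.rename_rename, image_rename_erase hz]
    rw [Proc.rename_congr (rename_comp_update hz)]
  | cut hP hQ =>
    simp only [Proc.rename, Proc.subst, Proc.fn_rename, Proc.rename_rename, ← Finset.image_union]
    rw [image_rename_erase (by simp [hP, hQ]), Proc.rename_congr (rename_comp_update hP),
      Proc.rename_congr (rename_comp_update hQ)]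

theorem PreCong.fn_subset {R : Proc Tag Nm → Proc Tag Nm → Prop}
    (hR : ∀ P Q, R P Q → Q.fn ⊆ P.fn) {P Q : Proc Tag Nm} (h : PreCong R P Q) : Q.fn ⊆ P.fn := by
  induction h with
  | base h => exact hR _ _ h
  | refl P => exact Finset.Subset.refl _
  | trans _ _ ih₁ ih₂ => exact ih₂.trans ih₁
  | select x a _ ih => exact Finset.insert_subset_insert _ ih
  | fork x y _ _ ih₁ ih₂ =>
    exact Finset.insert_subset_insert _
      (Finset.union_subset_union (Finset.erase_subset_erase _ ih₁) ih₂)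
  | choice _ _ ih₁ ih₂ => exact Finset.union_subset_union ih₁ ih₂
  | wait x _ ih => exact Finset.insert_subset_insert _ ih
  | case x I _ ih =>
    exact Finset.insert_subset_insert _ (Finset.biUnion_mono fun a _ => ih a)
  | join x y _ ih => exact Finset.insert_subset_insert _ (Finset.erase_subset_erase _ ih)
  | cut x _ _ ih₁ ih₂ => exact Finset.erase_subset_erase _ (Finset.union_subset_union ih₁ ih₂)

/-- Renaming does not distinguish alpha-equivalent processes; in particular `rename id` computes a
canonical representative. -/
theorem AlphaEq.rename_eq {P Q : Proc Tag Nm} (h : AlphaEq P Q) (ρ : Chan → Chan) :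
    P.rename ρ = Q.rename ρ := by
  have fn_eq : ∀ {P Q : Proc Tag Nm}, P.rename id = Q.rename id → P.fn = Q.fn := by
    intro P Q h
    simpa [Proc.fn_rename] using congrArg Proc.fn h
  unfold AlphaEq at h
  induction h generalizing ρ with
  | base h => exact h.elim (fun h => h.rename_eq ρ) fun h => (h.rename_eq ρ).symm
  | refl P => rfl
  | trans _ _ ih₁ ih₂ => exact (ih₁ ρ).trans (ih₂ ρ)
  | select x a _ ih => simp [Proc.rename, ih]
  | fork x y _ _ ih₁ ih₂ => simp [Proc.rename, ih₁, ih₂, fn_eq (ih₁ id)]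
  | choice _ _ ih₁ ih₂ => simp [Proc.rename, ih₁, ih₂]
  | wait x _ ih => simp [Proc.rename, ih]
  | case x I _ ih => simp [Proc.rename, ih]
  | join x y _ ih => simp [Proc.rename, ih, fn_eq (ih id)]
  | cut x _ _ ih₁ ih₂ => simp [Proc.rename, ih₁, ih₂, fn_eq (ih₁ id), fn_eq (ih₂ id)]

theorem Proc.choiceFree_rename {P : Proc Tag Nm} {ρ : Chan → Chan} :
    (P.rename ρ).ChoiceFree ↔ P.ChoiceFree := by
  induction P generalizing ρ <;> simp_all [Proc.rename, Proc.ChoiceFree]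

theorem Proc.invokes_rename {A : Nm} {P : Proc Tag Nm} {ρ : Chan → Chan} :
    (P.rename ρ).Invokes A ↔ P.Invokes A := by
  induction P generalizing ρ <;> simp_all [Proc.rename, Proc.Invokes]

end

/-! ### Affine typing -/

section

variable {Tag Nm : Type}

/-- One application of a rule of affine typing, with premises in `X`. Contexts are total functions of
which only the values at free channels matter, so that weakening is built in and the linearity of
channels is expressed by the disjointness of sets of free channels. Subtyping is allowed at the
subject of each prefix and the measure may be increased at will; non-deterministic choices are not
typable. The rules are directed by the process as it is written, with a binder shadowing the channels
of the same name. -/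
def AffineRule (D : Program Tag Nm) (X : ℕ → Proc Tag Nm → (Chan → Tree Tag) → Prop) (n : ℕ)
    (P : Proc Tag Nm) (G : Chan → Tree Tag) : Prop :=
  match P with
  | .link x y => x ≠ y ∧ 1 ≤ n ∧ Le (G x).dual (G y)
  | .close x => 1 ≤ n ∧ Le (.unit true) (G x)
  | .select x a P => ∃ k m S, k + m + 1 ≤ n ∧ Le (.outTag a m S) (G x) ∧
      X k P (Function.update G x S)
  | .fork x y P Q => ∃ k l T S, k + l + 1 ≤ n ∧ Le (.mult true T S) (G x) ∧
      X k P (Function.update G y T) ∧ X l Q (Function.update G x S) ∧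
      Disjoint (P.fn.erase y) (insert x Q.fn)
  | .choice _ _ => False
  | .done => True
  | .call A xs => xs.length = (D A).params.length ∧ X n (D.unfold A xs) G
  | .wait x P => x ∉ P.fn ∧ Le (.unit false) (G x) ∧ X n P G
  | .case x I P => ∃ (J : Finset Tag) (m : {a // a ∈ J} → ℕ) (S : {a // a ∈ J} → Tree Tag),
      Le (.branch false J m S) (G x) ∧
      ∀ a : {a // a ∈ J}, ∃ h : a.1 ∈ I, X (n + m a) (P ⟨a, h⟩) (Function.update G x (S a))
  | .join x y P => ∃ T S, Le (.mult false T S) (G x) ∧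
      X n P (Function.update (Function.update G x S) y T)
  | .cut x P Q => ∃ k l S T, k + l ≤ n ∧ Correct S T ∧ X k P (Function.update G x S) ∧
      X l Q (Function.update G x T) ∧ Disjoint (P.fn.erase x) (Q.fn.erase x)

/-- Affine typing: the largest relation that is consistent with the rules. -/
def Affine (D : Program Tag Nm) (n : ℕ) (P : Proc Tag Nm) (G : Chan → Tree Tag) : Prop :=
  ∃ X : ℕ → Proc Tag Nm → (Chan → Tree Tag) → Prop,
    (∀ n P G, X n P G → AffineRule D X n P G) ∧ X n P G

variable {D : Program Tag Nm} {n : ℕ} {P : Proc Tag Nm} {G : Chan → Tree Tag}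

theorem AffineRule.mono {X Y : ℕ → Proc Tag Nm → (Chan → Tree Tag) → Prop}
    (h : ∀ n P G, X n P G → Y n P G) (hX : AffineRule D X n P G) : AffineRule D Y n P G := by
  cases P with
  | link | close | choice | done => exact hX
  | select x a P =>
    obtain ⟨k, m, S, hn, hS, hP⟩ := hX
    exact ⟨k, m, S, hn, hS, h _ _ _ hP⟩
  | fork x y P Q =>
    obtain ⟨k, l, T, S, hn, hS, hP, hQ, hd⟩ := hX
    exact ⟨k, l, T, S, hn, hS, h _ _ _ hP, h _ _ _ hQ, hd⟩
  | call A xs => exact ⟨hX.1, h _ _ _ hX.2⟩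
  | wait x P => exact ⟨hX.1, hX.2.1, h _ _ _ hX.2.2⟩
  | case x I P =>
    obtain ⟨J, m, S, hS, hP⟩ := hX
    exact ⟨J, m, S, hS, fun a => ⟨(hP a).1, h _ _ _ (hP a).2⟩⟩
  | join x y P =>
    obtain ⟨T, S, hS, hP⟩ := hX
    exact ⟨T, S, hS, h _ _ _ hP⟩
  | cut x P Q =>
    obtain ⟨k, l, S, T, hn, hS, hP, hQ, hd⟩ := hX
    exact ⟨k, l, S, T, hn, hS, h _ _ _ hP, h _ _ _ hQ, hd⟩

theorem Affine.unfold (h : Affine D n P G) : AffineRule D (Affine D) n P G := by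
  obtain ⟨X, hX, h⟩ := h
  exact (hX _ _ _ h).mono fun _ _ _ h => ⟨X, hX, h⟩

theorem Affine.fold (h : AffineRule D (Affine D) n P G) : Affine D n P G :=
  ⟨AffineRule D (Affine D), fun _ _ _ h => h.mono fun _ _ _ h => h.unfold, h⟩

/-- `ρ` and `σ` identify some channels of `s` and `t` in a one-to-one way, and the types that `G`
assigns to the former are subtypes of those that `G'` assigns to the latter. -/
structure Compat (ρ σ : Chan → Chan) (s t : Finset Chan) (G G' : Chan → Tree Tag) : Prop where
  left : Set.InjOn ρ s
  right : Set.InjOn σ t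
  le : ∀ a ∈ s, ∀ b ∈ t, ρ a = σ b → Le (G a) (G' b)

namespace Compat

variable {ρ σ : Chan → Chan} {s s' t t' : Finset Chan} {G' : Chan → Tree Tag}

theorem mono (h : Compat ρ σ s t G G') (hs : s' ⊆ s) (ht : t' ⊆ t) : Compat ρ σ s' t' G G' :=
  ⟨h.left.mono hs, h.right.mono ht, fun a ha b hb => h.le a (hs ha) b (ht hb)⟩

theorem update (h : Compat ρ σ s t G G') {x x' : Chan} (hx : x ∈ s) (hx' : x' ∈ t)
    (hxx' : ρ x = σ x') (S : Tree Tag) :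
    Compat ρ σ s t (Function.update G x S) (Function.update G' x' S) := by
  refine ⟨h.left, h.right, fun a ha b hb hab => ?_⟩
  by_cases hax : a = x
  · obtain rfl : b = x' := h.right hb hx' (by rw [← hab, hax, hxx'])
    simp [hax, Le.refl]
  · have hbx : b ≠ x' := by
      rintro rfl
      exact hax (h.left ha hx (by rw [hab, hxx']))
    simpa [hax, hbx] using h.le a ha b hb hab

/-- Passage under a binder, renamed to the same fresh channel `z` on both sides. -/
theorem bind {y y' z : Chan} (h : Compat ρ σ (s.erase y) (t.erase y') G G')
    (hs : z ∉ (s.erase y).image ρ) (ht : z ∉ (t.erase y').image σ) (S : Tree Tag) :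
    Compat (Function.update ρ y z) (Function.update σ y' z) s t (Function.update G y S)
      (Function.update G' y' S) := by
  refine ⟨injOn_update hs h.left, injOn_update ht h.right, fun a ha b hb hab => ?_⟩
  simp only [Finset.mem_image, Finset.mem_erase, not_exists, not_and, and_imp] at hs ht
  by_cases hay : a = y <;> by_cases hby : b = y'
  · simp [hay, hby, Le.refl]
  · exact absurd (by simpa [hay, hby] using hab.symm) (ht b hby hb)
  · exact absurd (by simpa [hay, hby] using hab) (hs a hay ha)
  · simpa [hay, hby] using h.le a (by simp [hay, ha]) b (by simp [hby, hb])
      (by simpa [hay, hby] using hab)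

theorem disjoint {s₁ s₂ t₁ t₂ : Finset Chan} (hρ : Set.InjOn ρ s)
    (h₁ : s₁.image ρ = t₁.image σ) (h₂ : s₂.image ρ = t₂.image σ) (hs₁ : s₁ ⊆ s) (hs₂ : s₂ ⊆ s)
    (h : Disjoint s₁ s₂) : Disjoint t₁ t₂ := by
  rw [Finset.disjoint_left] at h ⊢
  intro a ha₁ ha₂
  obtain ⟨b, hb, hba⟩ := Finset.mem_image.1 (h₁ ▸ Finset.mem_image_of_mem σ ha₁)
  obtain ⟨c, hc, hca⟩ := Finset.mem_image.1 (h₂ ▸ Finset.mem_image_of_mem σ ha₂)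
  obtain rfl : b = c := hρ (hs₁ hb) (hs₂ hc) (hba.trans hca.symm)
  exact h hb hc

end Compat

theorem paramMap_map (ρ : Chan → Chan) :
    ∀ {ps xs : List Chan}, xs.length = ps.length → ∀ z ∈ ps,
      paramMap ps (xs.map ρ) z = ρ (paramMap ps xs z)
  | p :: ps, x :: xs, h, z, hz => by
    simp only [List.map_cons, paramMap, Function.update_apply]
    split_ifs with hzp
    · rfl
    · exact paramMap_map ρ (by simpa using h) z (by simpa [hzp] using hz)

theorem paramMap_mem : ∀ {ps xs : List Chan}, xs.length = ps.length → ∀ z ∈ ps,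
      paramMap ps xs z ∈ xs
  | p :: ps, x :: xs, h, z, hz => by
    simp only [paramMap, Function.update_apply]
    split_ifs with hzp
    · simp
    · exact List.mem_cons_of_mem _ (paramMap_mem (by simpa using h) z (by simpa [hzp] using hz))

theorem Program.WellFormed.rename_unfold (hD : D.WellFormed) {A : Nm} {xs : List Chan}
    (h : xs.length = (D A).params.length) (ρ : Chan → Chan) :
    (D.unfold A xs).rename ρ = D.unfold A (xs.map ρ) := by
  rw [Program.unfold, Proc.rename_rename, Program.unfold]
  refine Proc.rename_congr fun z hz => (paramMap_map ρ h z ?_).symm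
  rw [hD.fn_body] at hz
  simpa using hz

theorem Program.WellFormed.fn_unfold_subset (hD : D.WellFormed) {A : Nm} {xs : List Chan}
    (h : xs.length = (D A).params.length) : (D.unfold A xs).fn ⊆ xs.toFinset := by
  intro z hz
  rw [Program.unfold, Proc.fn_rename, hD.fn_body] at hz
  obtain ⟨p, hp, rfl⟩ := Finset.mem_image.1 hz
  simpa using paramMap_mem h p (by simpa using hp)

/-- Coinduction up to alpha-equivalence, injective renaming, subtyping of the context and increase of
the measure. -/
theorem Affine.coinduct (hD : D.WellFormed) {Y : ℕ → Proc Tag Nm → (Chan → Tree Tag) → Prop}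
    (hY : ∀ n P G, Y n P G → ∃ P', P.rename id = P'.rename id ∧ AffineRule D Y n P' G)
    {n' : ℕ} {Q : Proc Tag Nm} {G' : Chan → Tree Tag} {ρ σ : Chan → Chan} (h : Y n P G)
    (hn : n ≤ n') (hPQ : P.rename ρ = Q.rename σ) (hc : Compat ρ σ P.fn Q.fn G G') :
    Affine D n' Q G' := by
  refine ⟨fun n' Q G' => ∃ n P G ρ σ, Y n P G ∧ n ≤ n' ∧ P.rename ρ = Q.rename σ ∧
    Compat ρ σ P.fn Q.fn G G', ?_, n, P, G, ρ, σ, h, hn, hPQ, hc⟩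
  clear h hn hPQ hc
  rintro n' R G' ⟨n, P₀, G, ρ, σ, h, hn, hPQ, hc⟩
  obtain ⟨P, hP, h⟩ := hY _ _ _ h
  have hPP : P₀.rename ρ = P.rename ρ := by
    have := congrArg (Proc.rename ρ) hP
    simpa [Proc.rename_rename] using this
  have hfn : P₀.fn = P.fn := by
    simpa [Proc.fn_rename] using congrArg Proc.fn hP
  -- The rule is applied to an alpha-variant of the process, which has the same image under `ρ`.
  rw [hPP] at hPQ
  rw [hfn] at hc
  clear hP hPP hfn
  cases P with
  | link x y =>
    cases R with
    | link x' y' =>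
      simp only [Proc.rename, Proc.link.injEq] at hPQ
      obtain ⟨hxy, h1, hS⟩ := h
      refine ⟨?_, by omega, ?_⟩
      · rintro rfl
        exact hxy (hc.left (by simp [Proc.fn]) (by simp [Proc.fn]) (hPQ.1.trans hPQ.2.symm))
      · have h₁ := hc.le x (by simp [Proc.fn]) x' (by simp [Proc.fn]) hPQ.1
        have h₂ := hc.le y (by simp [Proc.fn]) y' (by simp [Proc.fn]) hPQ.2
        exact h₁.dual.trans (hS.trans h₂)
    | _ => simp [Proc.rename] at hPQ
  | close x =>
    cases R with
    | close x' =>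
      simp only [Proc.rename, Proc.close.injEq] at hPQ
      exact ⟨h.1.trans hn, h.2.trans (hc.le x (by simp [Proc.fn]) x' (by simp [Proc.fn]) hPQ)⟩
    | _ => simp [Proc.rename] at hPQ
  | select x a P =>
    cases R with
    | select x' a' Q =>
      simp only [Proc.rename, Proc.select.injEq] at hPQ
      obtain ⟨hx, rfl, hPQ⟩ := hPQ
      obtain ⟨k, m, S, hk, hS, h⟩ := h
      exact ⟨k, m, S, by omega, hS.trans (hc.le x (by simp [Proc.fn]) x' (by simp [Proc.fn]) hx),
        k, P, _, ρ, σ, h, le_rfl, hPQ,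
        (hc.update (by simp [Proc.fn]) (by simp [Proc.fn]) hx S).mono (Finset.subset_insert _ _)
          (Finset.subset_insert _ _)⟩
    | _ => simp [Proc.rename] at hPQ
  | fork x y P Q =>
    cases R with
    | fork x' y' P' Q' =>
      simp only [Proc.rename, Proc.fork.injEq] at hPQ
      obtain ⟨hx, hz, hP, hQ⟩ := hPQ
      obtain ⟨k, l, T, S, hk, hS, h₁, h₂, hd⟩ := h
      have hz₁ := fresh_notMem ((P.fn.erase y).image ρ)
      have hz₂ := fresh_notMem ((P'.fn.erase y').image σ)
      rw [← hz] at hz₂ hP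
      have hfP := congrArg Proc.fn hP
      have hfQ := congrArg Proc.fn hQ
      rw [Proc.fn_rename, Proc.fn_rename] at hfP hfQ
      refine ⟨k, l, T, S, by omega,
        hS.trans (hc.le x (by simp [Proc.fn]) x' (by simp [Proc.fn]) hx),
        ⟨k, P, _, _, _, h₁, le_rfl, hP, (hc.mono ?_ ?_).bind hz₁ hz₂ T⟩,
        ⟨l, Q, _, ρ, σ, h₂, le_rfl, hQ,
          (hc.update (by simp [Proc.fn]) (by simp [Proc.fn]) hx S).mono ?_ ?_⟩,
        Compat.disjoint (σ := σ) hc.left ?fnP ?fnQ ?_ ?_ hd⟩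
      case fnP => rw [← image_update hz₁, ← image_update hz₂, hfP]
      case fnQ => rw [Finset.image_insert, Finset.image_insert, hfQ, hx]
      all_goals intro a; simp only [Proc.fn, Finset.mem_insert, Finset.mem_union]; tauto
    | _ => simp [Proc.rename] at hPQ
  | choice P Q => exact h.elim
  | done =>
    cases R with
    | done => trivial
    | _ => simp [Proc.rename] at hPQ
  | call A xs =>
    cases R with
    | call A' xs' =>
      simp only [Proc.rename, Proc.call.injEq] at hPQ
      obtain ⟨rfl, hxs⟩ := hPQ
      have hl : xs'.length = (D A).params.length := by
        rw [← h.1, ← List.length_map (as := xs) ρ, hxs, List.length_map]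
      refine ⟨hl, n, _, G, ρ, σ, h.2, hn, ?_, ?_⟩
      · rw [hD.rename_unfold h.1, hD.rename_unfold hl, hxs]
      · exact hc.mono (hD.fn_unfold_subset h.1) (hD.fn_unfold_subset hl)
    | _ => simp [Proc.rename] at hPQ
  | wait x P =>
    cases R with
    | wait x' Q =>
      simp only [Proc.rename, Proc.wait.injEq] at hPQ
      obtain ⟨hx, hPQ⟩ := hPQ
      have hf := congrArg Proc.fn hPQ
      rw [Proc.fn_rename, Proc.fn_rename] at hf
      refine ⟨?_, h.2.1.trans (hc.le x (by simp [Proc.fn]) x' (by simp [Proc.fn]) hx),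
        n, P, G, ρ, σ, h.2.2, hn, hPQ,
        hc.mono (Finset.subset_insert _ _) (Finset.subset_insert _ _)⟩
      have hd : Disjoint {x} P.fn := by simpa using h.1
      simpa using Compat.disjoint (t₁ := {x'}) hc.left (by simp [hx]) hf
        (by simp [Proc.fn]) (Finset.subset_insert _ _) hd
    | _ => simp [Proc.rename] at hPQ
  | case x I P =>
    cases R with
    | case x' I' Q =>
      simp only [Proc.rename, Proc.case.injEq] at hPQ
      obtain ⟨hx, rfl, hPQ⟩ := hPQ
      have hPQ := eq_of_heq hPQ
      obtain ⟨J, m, S, hS, h⟩ := h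
      refine ⟨J, m, S, hS.trans (hc.le x (by simp [Proc.fn]) x' (by simp [Proc.fn]) hx),
        fun a => ⟨(h a).1, n + m a, P ⟨a, (h a).1⟩, _, ρ, σ, (h a).2, by omega,
          congrFun hPQ ⟨a, (h a).1⟩,
          (hc.update (by simp [Proc.fn]) (by simp [Proc.fn]) hx (S a)).mono ?_ ?_⟩⟩
      all_goals
        intro b hb
        simp only [Proc.fn, Finset.mem_insert, Finset.mem_biUnion]
        exact Or.inr ⟨⟨a, (h a).1⟩, Finset.mem_attach _ _, hb⟩
    | _ => simp [Proc.rename] at hPQ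
  | join x y P =>
    cases R with
    | join x' y' Q =>
      simp only [Proc.rename, Proc.join.injEq] at hPQ
      obtain ⟨hx, hz, hPQ⟩ := hPQ
      obtain ⟨T, S, hS, h⟩ := h
      have hz₁ := fresh_notMem ((P.fn.erase y).image ρ)
      have hz₂ := fresh_notMem ((Q.fn.erase y').image σ)
      rw [← hz] at hz₂ hPQ
      exact ⟨T, S, hS.trans (hc.le x (by simp [Proc.fn]) x' (by simp [Proc.fn]) hx),
        n, P, _, _, _, h, hn, hPQ,
        ((hc.update (by simp [Proc.fn]) (by simp [Proc.fn]) hx S).mono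
          (Finset.subset_insert _ _) (Finset.subset_insert _ _)).bind hz₁ hz₂ T⟩
    | _ => simp [Proc.rename] at hPQ
  | cut x P Q =>
    cases R with
    | cut x' P' Q' =>
      simp only [Proc.rename, Proc.cut.injEq] at hPQ
      obtain ⟨hz, hP, hQ⟩ := hPQ
      obtain ⟨k, l, S, T, hk, hS, h₁, h₂, hd⟩ := h
      have hz₁ := fresh_notMem (((P.fn ∪ Q.fn).erase x).image ρ)
      have hz₂ := fresh_notMem (((P'.fn ∪ Q'.fn).erase x').image σ)
      rw [← hz] at hz₂ hP hQ
      have hfP := congrArg Proc.fn hP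
      have hfQ := congrArg Proc.fn hQ
      rw [Proc.fn_rename, Proc.fn_rename] at hfP hfQ
      have mem : ∀ {A B : Finset Chan} {y : Chan}, A ⊆ B → A.erase y ⊆ B.erase y :=
        fun h => Finset.erase_subset_erase _ h
      have nm : ∀ {s t : Finset Chan} {f : Chan → Chan} {z : Chan}, s ⊆ t → z ∉ t.image f →
          z ∉ s.image f := fun h h' h'' => h' (Finset.image_subset_image h h'')
      refine ⟨k, l, S, T, by omega, hS,
        ⟨k, P, _, _, _, h₁, le_rfl, hP,
          (hc.bind hz₁ hz₂ S).mono Finset.subset_union_left Finset.subset_union_left⟩,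
        ⟨l, Q, _, _, _, h₂, le_rfl, hQ,
          (hc.bind hz₁ hz₂ T).mono Finset.subset_union_right Finset.subset_union_right⟩,
        Compat.disjoint (σ := σ) hc.left ?_ ?_ (mem Finset.subset_union_left)
          (mem Finset.subset_union_right) hd⟩
      · rw [← image_update (nm (mem Finset.subset_union_left) hz₁), hfP,
          ← image_update (nm (mem Finset.subset_union_left) hz₂)]
      · rw [← image_update (nm (mem Finset.subset_union_right) hz₁), hfQ,
          ← image_update (nm (mem Finset.subset_union_right) hz₂)]
    | _ => simp [Proc.rename] at hPQ

/-- Affine typing is invariant under alpha-equivalence and injective renaming. -/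
theorem Affine.transport (hD : D.WellFormed) {n' : ℕ} {Q : Proc Tag Nm}
    {G' : Chan → Tree Tag} {ρ σ : Chan → Chan} (h : Affine D n P G) (hn : n ≤ n')
    (hPQ : P.rename ρ = Q.rename σ) (hc : Compat ρ σ P.fn Q.fn G G') : Affine D n' Q G' :=
  Affine.coinduct hD (fun _ P _ h => ⟨P, rfl, h.unfold⟩) h hn hPQ hc

/-- Weakening: only the free channels matter, and their types may be replaced by supertypes. -/
theorem Affine.weaken (hD : D.WellFormed) {n' : ℕ} {G' : Chan → Tree Tag} (h : Affine D n P G)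
    (hn : n ≤ n') (hG : ∀ z ∈ P.fn, Le (G z) (G' z)) : Affine D n' P G' :=
  h.transport hD hn (ρ := id) (σ := id) rfl
    ⟨Set.injOn_id _, Set.injOn_id _, fun a ha b _ hab => by
      obtain rfl : a = b := hab; exact hG a ha⟩

theorem Affine.congr (hD : D.WellFormed) {G' : Chan → Tree Tag} (h : Affine D n P G)
    (hG : ∀ z ∈ P.fn, G z = G' z) : Affine D n P G' :=
  h.weaken hD le_rfl fun z hz => hG z hz ▸ Le.refl _

theorem Affine.alpha (hD : D.WellFormed) {Q : Proc Tag Nm} (h : Affine D n P G)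
    (hPQ : AlphaEq P Q) : Affine D n Q G :=
  h.transport hD le_rfl (ρ := id) (σ := id) (hPQ.rename_eq id)
    ⟨Set.injOn_id _, Set.injOn_id _, fun a _ b _ hab => by
      obtain rfl : a = b := hab; exact Le.refl _⟩

theorem Affine.rename (hD : D.WellFormed) {ρ : Chan → Chan} {G' : Chan → Tree Tag}
    (h : Affine D n P G) (hρ : Set.InjOn ρ P.fn) (hG : ∀ z ∈ P.fn, Le (G z) (G' (ρ z))) :
    Affine D n (P.rename ρ) G' :=
  h.transport hD le_rfl (ρ := ρ) (σ := id) (by rw [Proc.rename_rename]; rfl)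
    ⟨hρ, Set.injOn_id _, fun a ha b _ hab => by
      obtain rfl : ρ a = b := hab; exact hG a ha⟩

end

/-! ### From typing to affine typing -/

section

variable {Tag Nm : Type}

/-- The height of the syntax tree of a process. -/
def Proc.height : Proc Tag Nm → ℕ
  | select _ _ P => height P + 1
  | fork _ _ P Q => max (height P) (height Q) + 1
  | choice P Q => max (height P) (height Q) + 1
  | wait _ P => height P + 1
  | case _ I P => (I.attach.sup fun a => height (P a)) + 1
  | join _ _ P => height P + 1
  | cut _ P Q => max (height P) (height Q) + 1
  | _ => 0

theorem Proc.height_rename (P : Proc Tag Nm) (ρ : Chan → Chan) :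
    (P.rename ρ).height = P.height := by
  induction P generalizing ρ <;> simp_all [rename, height]

theorem AlphaEq.fn_eq {P Q : Proc Tag Nm} (h : AlphaEq P Q) : P.fn = Q.fn := by
  simpa [Proc.fn_rename] using congrArg Proc.fn (h.rename_eq id)

/-- The relations of which typing is the largest. -/
def Consistent (D : Program Tag Nm) (X : ℕ → Proc Tag Nm → Ctx Tag → Prop) : Prop :=
  ∀ n P Γ, X n P Γ →
    (∀ z S, Γ z = some S → S.Regular) ∧ ∃ P', AlphaEq P P' ∧ TypingRule D X n P' Γ

theorem Ctx.ext_of_ne {Γ : Ctx Tag} {x z : Chan} {S : Tree Tag} (h : z ≠ x) :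
    Γ.ext x S z = Γ z := by
  simp [Ctx.ext, h]

theorem Ctx.ext_self {Γ : Ctx Tag} {x : Chan} {S : Tree Tag} : Γ.ext x S x = some S := by
  simp [Ctx.ext]

theorem Ctx.ext_ne_none {Γ : Ctx Tag} {x z : Chan} {S : Tree Tag} :
    Γ.ext x S z ≠ none ↔ z = x ∨ Γ z ≠ none := by
  by_cases h : z = x
  · simp [h, ext_self]
  · simp [h, ext_of_ne]

theorem Ctx.union_ne_none {Γ Δ : Ctx Tag} {z : Chan} :
    Γ.union Δ z ≠ none ↔ Γ z ≠ none ∨ Δ z ≠ none := by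
  cases h : Γ z <;> simp [union, h]

variable {D : Program Tag Nm} {X : ℕ → Proc Tag Nm → Ctx Tag → Prop}

/-- A typed process contains only channels of its context. The induction is on the height because the
typing rules apply to alpha-equivalent processes, of which the premises are not subterms. -/
theorem Consistent.fn_subset_dom (hX : Consistent D X) :
    ∀ (N : ℕ) {n : ℕ} {P : Proc Tag Nm} {Γ : Ctx Tag}, P.height < N → X n P Γ →
      ∀ z ∈ P.fn, Γ z ≠ none
  | N + 1, n, P, Γ, hN, h => by
    have ih := fun {n P Γ} => hX.fn_subset_dom N (n := n) (P := P) (Γ := Γ)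
    obtain ⟨-, P', hP, h⟩ := hX _ _ _ h
    have hh := congrArg Proc.height (hP.rename_eq id)
    rw [Proc.height_rename, Proc.height_rename] at hh
    rw [hh] at hN
    rw [hP.fn_eq]
    intro z hz
    clear hP hh
    cases h with
    | done => simp [Proc.fn] at hz
    | link =>
      simp only [Proc.fn, Finset.mem_insert, Finset.mem_singleton] at hz
      simp only [Ctx.ext_ne_none]
      tauto
    | call _ _ _ _ hd =>
      have : z ∈ Γ.dom := by rw [hd]; simpa [Proc.fn] using hz
      exact this
    | choiceL hP hQ | choiceR hP hQ =>
      simp only [Proc.height] at hN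
      simp only [Proc.fn, Finset.mem_union] at hz
      exact hz.elim (ih (by omega) hP z) (ih (by omega) hQ z)
    | cut _ _ _ _ hP hQ =>
      simp only [Proc.height] at hN
      simp only [Proc.fn, Finset.mem_union, Finset.mem_erase] at hz
      have h₁ := ih (by omega) hP z
      have h₂ := ih (by omega) hQ z
      rw [Ctx.ext_ne_none] at h₁ h₂
      rw [Ctx.union_ne_none]
      tauto
    | close =>
      simp only [Proc.fn, Finset.mem_singleton] at hz
      exact Ctx.ext_ne_none.2 (Or.inl hz)
    | wait _ hP =>
      simp only [Proc.height] at hN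
      simp only [Proc.fn, Finset.mem_insert] at hz
      exact Ctx.ext_ne_none.2 (hz.imp_right (ih (by omega) hP z))
    | select k _ hP =>
      simp only [Proc.height] at hN
      simp only [Proc.fn, Finset.mem_insert] at hz
      have h₁ := ih (by omega) hP z
      rw [Ctx.ext_ne_none] at h₁ ⊢
      tauto
    | @case n x Γ I J m S P hJ _ hP hf =>
      simp only [Proc.height] at hN
      simp only [Proc.fn, Finset.mem_insert, Finset.mem_biUnion, Finset.mem_attach,
        true_and] at hz
      rw [Ctx.ext_ne_none]
      obtain rfl | ⟨a, ha⟩ := hz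
      · exact Or.inl rfl
      · by_cases haJ : a.1 ∈ J
        · have hle : (P a).height ≤ I.attach.sup fun a => (P a).height :=
            Finset.le_sup (f := fun a => (P a).height) (Finset.mem_attach I a)
          have h₁ := ih (P := P a) (by omega) (hP ⟨a, haJ⟩) z ha
          rwa [Ctx.ext_ne_none] at h₁
        · exact hf a haJ z ha
    | fork _ _ _ _ hP hQ =>
      simp only [Proc.height] at hN
      simp only [Proc.fn, Finset.mem_union, Finset.mem_erase, Finset.mem_insert] at hz
      have h₁ := ih (by omega) hP z
      have h₂ := ih (by omega) hQ z
      rw [Ctx.ext_ne_none] at h₁ h₂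
      rw [Ctx.ext_ne_none, Ctx.union_ne_none]
      tauto
    | join _ _ _ hP =>
      simp only [Proc.height] at hN
      simp only [Proc.fn, Finset.mem_erase, Finset.mem_insert] at hz
      have h₁ := ih (by omega) hP z
      rw [Ctx.ext_ne_none, Ctx.ext_ne_none] at h₁
      rw [Ctx.ext_ne_none]
      tauto

/-- Typed processes without non-deterministic choice are affinely typed; `good` stands for the names
of the definitions that the process depends on. -/
theorem Consistent.affine (hD : D.WellFormed) (hX : Consistent D X) {good : Nm → Prop}
    (hgood : ∀ A, good A → (D A).body.ChoiceFree ∧ ∀ B, (D A).body.Invokes B → good B)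
    {n : ℕ} {P : Proc Tag Nm} {Γ : Ctx Tag} {G : Chan → Tree Tag} (h : X n P Γ)
    (hc : P.ChoiceFree) (hg : ∀ A, P.Invokes A → good A) (hG : ∀ z ∈ P.fn, Γ z = some (G z)) :
    Affine D n P G := by
  have dom : ∀ {n : ℕ} {P : Proc Tag Nm} {Γ : Ctx Tag}, X n P Γ → ∀ z ∈ P.fn, Γ z ≠ none :=
    fun h => hX.fn_subset_dom _ (Nat.lt_succ_self _) h
  have upd : ∀ {P : Proc Tag Nm} {Γ : Ctx Tag} {G : Chan → Tree Tag} {x : Chan} {S : Tree Tag},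
      (∀ z ∈ P.fn, z ≠ x → Γ z = some (G z)) →
        ∀ z ∈ P.fn, Γ.ext x S z = some (Function.update G x S z) := by
    intro P Γ G x S h z hz
    by_cases hzx : z = x
    · simp [hzx, Ctx.ext_self]
    · simpa [hzx, Ctx.ext_of_ne] using h z hz hzx
  have left : ∀ {Γ Δ : Ctx Tag} {z : Chan}, Γ z ≠ none → Γ.union Δ z = Γ z := by
    intro Γ Δ z h
    cases hz : Γ z <;> simp_all [Ctx.union]
  have right : ∀ {Γ Δ : Ctx Tag} {z : Chan}, Γ.Disjoint Δ → Δ z ≠ none → Γ.union Δ z = Δ z := by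
    intro Γ Δ z hd h
    have := (hd z).resolve_right h
    simp [Ctx.union, this]
  refine Affine.coinduct hD (Y := fun n P G => ∃ n₀ ≤ n, ∃ Γ, X n₀ P Γ ∧ P.ChoiceFree ∧
    (∀ A, P.Invokes A → good A) ∧ ∀ z ∈ P.fn, Γ z = some (G z)) ?_ (ρ := id) (σ := id)
    ⟨n, le_rfl, Γ, h, hc, hg, hG⟩ le_rfl rfl ⟨Set.injOn_id _, Set.injOn_id _, fun a _ b _ hab => by
      obtain rfl : a = b := hab; exact Le.refl _⟩
  clear h hc hg hG
  rintro n P G ⟨n₀, hn, Γ, h, hc, hg, hG⟩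
  obtain ⟨hreg, P', hP, h⟩ := hX _ _ _ h
  have e := hP.rename_eq id
  have hc : P'.ChoiceFree := by
    rw [← Proc.choiceFree_rename (ρ := id), e, Proc.choiceFree_rename] at hc
    exact hc
  have hg : ∀ A, P'.Invokes A → good A := fun A hA => hg A (by
    rw [← Proc.invokes_rename (ρ := id), ← e, Proc.invokes_rename] at hA
    exact hA)
  rw [hP.fn_eq] at hG
  refine ⟨P', e, ?_⟩
  clear hP e
  cases h with
  | done => trivial
  | @link n x y S T hxy hS =>
    have hx := hG x (by simp [Proc.fn])
    have hy := hG y (by simp [Proc.fn])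
    rw [Ctx.ext_of_ne hxy, Ctx.ext_self, Option.some_inj] at hx
    have hT := hreg y T Ctx.ext_self
    rw [Ctx.ext_self, Option.some_inj] at hy
    subst hx hy
    exact ⟨hxy, by omega, Le.of_sub hS hT⟩
  | @call m k A xs Γ hxs hl hd hP =>
    have hA := hgood A (hg A rfl)
    exact ⟨hl, k, by omega, Γ, hP, Proc.choiceFree_rename.2 hA.1,
      fun B hB => hA.2 B (Proc.invokes_rename.1 hB),
      fun z hz => hG z (hD.fn_unfold_subset hl hz)⟩
  | choiceL | choiceR => exact hc.elim
  | @cut m k x P Q S T Γ Δ hd hΓ hΔ hS hP hQ =>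
    have dP := dom hP
    have dQ := dom hQ
    simp only [Ctx.ext_ne_none] at dP dQ
    refine ⟨m, k, S, T, hn, hS,
      ⟨m, le_rfl, _, hP, hc.1, fun A hA => hg A (Or.inl hA), upd fun z hz hzx => ?_⟩,
      ⟨k, le_rfl, _, hQ, hc.2, fun A hA => hg A (Or.inr hA), upd fun z hz hzx => ?_⟩, ?_⟩
    · rw [← left ((dP z hz).resolve_left hzx)]
      exact hG z (by simp [Proc.fn, hz, hzx])
    · rw [← right hd ((dQ z hz).resolve_left hzx)]
      exact hG z (by simp [Proc.fn, hz, hzx])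
    · rw [Finset.disjoint_left]
      intro z hz hz'
      rw [Finset.mem_erase] at hz hz'
      exact (hd z).elim ((dP z hz.2).resolve_left hz.1) ((dQ z hz'.2).resolve_left hz.1)
  | @close _ x =>
    have hx := hG x (by simp [Proc.fn])
    rw [Ctx.ext_self, Option.some_inj] at hx
    exact ⟨by omega, hx ▸ Le.refl _⟩
  | @wait _ x P Γ hΓ hP =>
    have hx := hG x (by simp [Proc.fn])
    rw [Ctx.ext_self, Option.some_inj] at hx
    have hxP : x ∉ P.fn := fun h => dom hP x h hΓ
    refine ⟨hxP, hx ▸ Le.refl _, n₀, hn, Γ, hP, hc, hg, fun z hz => ?_⟩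
    rw [← hG z (by simp [Proc.fn, hz]), Ctx.ext_of_ne]
    rintro rfl
    exact hxP hz
  | @select k x P I m S Γ a hΓ hP =>
    have hx := hG x (by simp [Proc.fn])
    rw [Ctx.ext_self, Option.some_inj] at hx
    refine ⟨k, m a, S a, by omega, hx ▸ Le.outTag (.mustBranch true m S a), k, le_rfl, _, hP,
      hc, hg, upd fun z hz hzx => ?_⟩
    rw [← hG z (by simp [Proc.fn, hz]), Ctx.ext_of_ne hzx]
  | @case _ x Γ I J m S P hJ hΓ hP _ =>
    have hx := hG x (by simp [Proc.fn])
    rw [Ctx.ext_self, Option.some_inj] at hx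
    refine ⟨J, m, S, hx ▸ Le.refl _, fun a => ⟨hJ a.2, n₀ + m a, by omega, _, hP a, hc _,
      fun A hA => hg A ⟨_, hA⟩, upd fun z hz hzx => ?_⟩⟩
    rw [← hG z, Ctx.ext_of_ne hzx]
    simp only [Proc.fn, Finset.mem_insert, Finset.mem_biUnion]
    exact Or.inr ⟨_, Finset.mem_attach _ _, hz⟩
  | @fork m k x y P Q S T Γ Δ hd hΓ hΔ hy hP hQ =>
    have hx := hG x (by simp [Proc.fn])
    rw [Ctx.ext_self, Option.some_inj] at hx
    have dP := dom hP
    have dQ := dom hQ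
    simp only [Ctx.ext_ne_none] at dP dQ
    refine ⟨m, k, T, S, by omega, hx ▸ Le.refl _,
      ⟨m, le_rfl, _, hP, hc.1, fun A hA => hg A (Or.inl hA), upd fun z hz hzy => ?_⟩,
      ⟨k, le_rfl, _, hQ, hc.2, fun A hA => hg A (Or.inr hA), upd fun z hz hzx => ?_⟩, ?_⟩
    · have hz' := (dP z hz).resolve_left hzy
      have hzx : z ≠ x := by rintro rfl; exact hz' hΓ
      rw [← left hz']
      exact (Ctx.ext_of_ne hzx).symm.trans (hG z (by simp [Proc.fn, hz, hzy]))
    · rw [← right hd ((dQ z hz).resolve_left hzx)]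
      exact (Ctx.ext_of_ne hzx).symm.trans (hG z (by simp [Proc.fn, hz]))
    · rw [Finset.disjoint_left]
      intro z hz hz'
      rw [Finset.mem_erase] at hz
      have h₁ := (dP z hz.2).resolve_left hz.1
      rw [Finset.mem_insert] at hz'
      by_cases hzx : z = x
      · exact h₁ (hzx ▸ hΓ)
      · exact (hd z).elim h₁ ((dQ z (hz'.resolve_left hzx)).resolve_left hzx)
  | @join _ x y P S T Γ hxy hΓ hy hP =>
    have hx := hG x (by simp [Proc.fn])
    rw [Ctx.ext_self, Option.some_inj] at hx
    refine ⟨T, S, hx ▸ Le.refl _, n₀, hn, _, hP, hc, hg, ?_⟩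
    rw [Function.update_comm hxy]
    refine upd fun z hz hzx => ?_
    by_cases hzy : z = y
    · simp [hzy, Ctx.ext_self]
    · rw [Ctx.ext_of_ne hzy, Function.update_of_ne hzy, ← hG z (by simp [Proc.fn, hz, hzy]),
        Ctx.ext_of_ne hzx]

end

/-! ### Buffers -/

section

variable {Tag Nm : Type}

theorem Buffer.mem_fn_fill {x z : Chan} {B : Buffer Tag Nm} {P : Proc Tag Nm} :
    z ∈ (B.fill x P).fn ↔ (B ≠ [] ∧ z = x) ∨ z ∈ B.fn ∨ z ∈ P.fn := by
  induction B with
  | nil => simp [fill, fn]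
  | cons M B ih =>
    cases M with
    | tag a =>
      simp only [fill, Proc.fn, fn, Finset.mem_insert, ih]
      tauto
    | chan y R =>
      simp only [fill, Proc.fn, fn, Finset.mem_insert, Finset.mem_union, ih]
      tauto

theorem Buffer.fn_subst (x y : Chan) (B : Buffer Tag Nm) :
    (B.subst x y).fn = B.fn.image (Function.update id x y) := by
  induction B with
  | nil => rfl
  | cons M B ih =>
    cases M with
    | tag a => exact ih
    | chan u R =>
      simp only [subst, fn, ih, Finset.image_union, Proc.fn_rename, image_update (fresh_notMem _)]

theorem image_update_id {s : Finset Chan} {x y : Chan} (h : x ∉ s) :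
    s.image (Function.update id x y) = s := by
  conv_rhs => rw [← Finset.image_id (s := s)]
  refine Finset.image_congr fun z hz => Function.update_of_ne ?_ _ _
  rintro rfl
  exact h hz

variable {D : Program Tag Nm} {n : ℕ} {P : Proc Tag Nm} {G G' : Chan → Tree Tag} {x : Chan}
  {B : Buffer Tag Nm} {S U V : Tree Tag}

/-- `BufferTyped D G x n B S U`: when `x` is used with type `S` after the messages of `B`, it has
type `U` before them; the messages contribute `n` to the measure. -/
def BufferTyped (D : Program Tag Nm) (G : Chan → Tree Tag) (x : Chan) :
    ℕ → Buffer Tag Nm → Tree Tag → Tree Tag → Prop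
  | _, [], S, U => Le S U
  | n, .tag a :: B, S, U => ∃ k m V, k + m + 1 ≤ n ∧ Le (.outTag a m V) U ∧
      BufferTyped D G x k B S V
  | n, .chan y R :: B, S, U => ∃ k l T V, k + l + 1 ≤ n ∧ Le (.mult true T V) U ∧
      Affine D k R (Function.update G y T) ∧ BufferTyped D G x l B S V ∧
      Disjoint (R.fn.erase y) (insert x (Buffer.fn B))

namespace BufferTyped

theorem notMem (h : BufferTyped D G x n B S U) : x ∉ B.fn := by
  induction B generalizing n U with
  | nil => simp [Buffer.fn]
  | cons M B ih =>
    cases M with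
    | tag a =>
      obtain ⟨k, m, V, -, -, h⟩ := h
      exact ih h
    | chan y R =>
      obtain ⟨k, l, T, V, -, -, -, h, hd⟩ := h
      rw [Buffer.fn, Finset.mem_union, not_or]
      exact ⟨Finset.disjoint_right.1 hd (Finset.mem_insert_self _ _), ih h⟩

theorem congr (hD : D.WellFormed) (h : BufferTyped D G x n B S U) (hG : ∀ z ∈ B.fn, G z = G' z) :
    BufferTyped D G' x n B S U := by
  induction B generalizing n U with
  | nil => exact h
  | cons M B ih =>
    cases M with
    | tag a =>
      obtain ⟨k, m, V, hn, hV, h⟩ := h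
      exact ⟨k, m, V, hn, hV, ih h hG⟩
    | chan y R =>
      obtain ⟨k, l, T, V, hn, hV, hR, h, hd⟩ := h
      simp only [Buffer.fn, Finset.mem_union, Finset.mem_erase] at hG
      refine ⟨k, l, T, V, hn, hV, hR.congr hD fun z hz => ?_, ih h fun z hz => hG z (Or.inr hz), hd⟩
      by_cases hzy : z = y
      · simp [hzy]
      · simp [hzy, hG z (Or.inl ⟨hzy, hz⟩)]

/-- The input of a tag by the type of the whole process takes place after the buffer. -/
theorem trans_tag {a : Tag} {m : ℕ} {U' : Tree Tag} (h : BufferTyped D G x n B V U)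
    (hU : Trans U false (.tag a m) U') :
    ∃ V', Trans V false (.tag a m) V' ∧ BufferTyped D G x n B V' U' := by
  induction B generalizing n U U' with
  | nil => exact Le.trans_tag h hU
  | cons M B ih =>
    cases M with
    | tag b =>
      obtain ⟨k, l, W, hn, hW, h⟩ := h
      obtain ⟨W', hW', hle⟩ := hW.trans_tag hU
      obtain ⟨W'', hW'', rfl⟩ := hW'.outTag_inv
      obtain ⟨V', hV', h⟩ := ih h hW''
      exact ⟨V', hV', k, l, W'', hn, hle, h⟩
    | chan y R =>
      obtain ⟨k, l, T, W, hn, hW, hR, h, hd⟩ := h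
      obtain ⟨W', hW', hle⟩ := hW.trans_tag hU
      obtain ⟨W'', hW'', rfl⟩ := Trans.mult_inv_may (p := true) hW'
      obtain ⟨V', hV', h⟩ := ih h hW''
      exact ⟨V', hV', k, l, T, W'', hn, hle, hR, h, hd⟩

/-- The input of a channel by the type of the whole process takes place after the buffer. -/
theorem trans_chan {T U' : Tree Tag} (h : BufferTyped D G x n B V U)
    (hU : Trans U false (.chan T) U') :
    ∃ T' V', Trans V false (.chan T') V' ∧ Le T' T ∧ BufferTyped D G x n B V' U' := by
  induction B generalizing n T U U' with
  | nil =>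
    obtain ⟨T', V', h₁, h₂, h₃⟩ := Le.trans_chan h hU
    exact ⟨T', V', h₁, h₂, h₃⟩
  | cons M B ih =>
    cases M with
    | tag b =>
      obtain ⟨k, l, W, hn, hW, h⟩ := h
      obtain ⟨T', W', hW', hT', hle⟩ := hW.trans_chan hU
      obtain ⟨W'', hW'', rfl⟩ := hW'.outTag_inv
      obtain ⟨T'', V', hV', hT'', h⟩ := ih h hW''
      exact ⟨T'', V', hV', hT''.trans hT', k, l, W'', hn, hle, h⟩
    | chan y R =>
      obtain ⟨k, l, T₀, W, hn, hW, hR, h, hd⟩ := h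
      obtain ⟨T', W', hW', hT', hle⟩ := hW.trans_chan hU
      obtain ⟨W'', hW'', rfl⟩ := Trans.mult_inv_may (p := true) hW'
      obtain ⟨T'', V', hV', hT'', h⟩ := ih h hW''
      exact ⟨T'', V', hV', hT''.trans hT', k, l, T₀, W'', hn, hle, hR, h, hd⟩

end BufferTyped

theorem update_eq_of_eq {G G' : Chan → Tree Tag} {s : Finset Chan} {y : Chan} {T : Tree Tag}
    (h : ∀ z ∈ s, z ≠ y → G z = G' z) :
    ∀ z ∈ s, Function.update G y T z = Function.update G' y T z := by
  intro z hz
  by_cases hzy : z = y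
  · simp [hzy]
  · simpa [hzy] using h z hz hzy

/-- Affine typing of a process that begins with a buffer. -/
theorem affine_fill (hD : D.WellFormed) : Affine D n (B.fill x P) G ↔
    ∃ k l S, k + l ≤ n ∧ BufferTyped D G x k B S (G x) ∧ Affine D l P (Function.update G x S) ∧
      Disjoint B.fn P.fn := by
  induction B generalizing n G with
  | nil =>
    constructor
    · exact fun h => ⟨0, n, G x, by omega, Le.refl _, by simpa [Buffer.fill] using h,
        by simp [Buffer.fn]⟩
    · rintro ⟨k, l, S, hn, hS, h, -⟩
      refine h.weaken hD (by omega) fun z _ => ?_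
      by_cases hzx : z = x
      · rw [hzx, Function.update_self]
        exact hS
      · simp [hzx, Le.refl]
  | cons M B ih =>
    have upd : ∀ (V : Tree Tag) {k l S}, BufferTyped D G x k B S V →
        Affine D l P (Function.update G x S) →
        BufferTyped D (Function.update G x V) x k B S (Function.update G x V x) ∧
        Affine D l P (Function.update (Function.update G x V) x S) := by
      intro V k l S h h'
      rw [Function.update_idem, Function.update_self]
      refine ⟨h.congr hD fun z hz => ?_, h'⟩
      rw [Function.update_of_ne]
      rintro rfl
      exact h.notMem hz
    have upd' : ∀ (V : Tree Tag) {k l S},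
        BufferTyped D (Function.update G x V) x k B S (Function.update G x V x) →
        Affine D l P (Function.update (Function.update G x V) x S) →
        BufferTyped D G x k B S V ∧ Affine D l P (Function.update G x S) := by
      intro V k l S h h'
      rw [Function.update_idem] at h'
      rw [Function.update_self] at h
      refine ⟨h.congr hD fun z hz => ?_, h'⟩
      rw [Function.update_of_ne]
      rintro rfl
      exact h.notMem hz
    cases M with
    | tag a =>
      constructor
      · intro h
        obtain ⟨k, m, V, hn, hV, h⟩ := h.unfold
        obtain ⟨k', l, S, hk, hB, hP, hd⟩ := ih.1 h
        obtain ⟨hB, hP⟩ := upd' V hB hP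
        exact ⟨k' + m + 1, l, S, by omega, ⟨k', m, V, le_rfl, hV, hB⟩, hP, hd⟩
      · rintro ⟨k', l, S, hn, ⟨k, m, V, hk, hV, hB⟩, hP, hd⟩
        obtain ⟨hB, hP⟩ := upd V hB hP
        exact .fold ⟨k + l, m, V, by omega, hV, ih.2 ⟨k, l, S, le_rfl, hB, hP, hd⟩⟩
    | chan y R =>
      constructor
      · intro h
        obtain ⟨k, l, T, V, hn, hV, hR, h, hd⟩ := h.unfold
        obtain ⟨k', l', S, hk, hB, hP, hd'⟩ := ih.1 h
        obtain ⟨hB, hP⟩ := upd' V hB hP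
        rw [Finset.disjoint_left] at hd
        simp only [Finset.mem_insert, Buffer.mem_fn_fill] at hd
        refine ⟨k + k' + 1, l', S, by omega, ⟨k, k', T, V, le_rfl, hV, hR, hB, ?_⟩, hP, ?_⟩
        · rw [Finset.disjoint_left]
          intro z hz hz'
          rw [Finset.mem_insert] at hz'
          have := hd hz
          tauto
        · rw [Buffer.fn, Finset.disjoint_union_left]
          refine ⟨?_, hd'⟩
          rw [Finset.disjoint_left]
          intro z hz hz'
          have := hd hz
          tauto
      · rintro ⟨k', l', S, hn, ⟨k, l, T, V, hk, hV, hR, hB, hd⟩, hP, hd'⟩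
        obtain ⟨hB, hP⟩ := upd V hB hP
        rw [Buffer.fn, Finset.disjoint_union_left] at hd'
        refine .fold ⟨k, l + l', T, V, by omega, hV, hR,
          ih.2 ⟨l, l', S, le_rfl, hB, hP, hd'.2⟩, ?_⟩
        rw [Finset.disjoint_left] at hd ⊢
        intro z hz hz'
        have h₁ := hd hz
        have h₂ := Finset.disjoint_left.1 hd'.1 hz
        simp only [Finset.mem_insert, Buffer.mem_fn_fill] at hz' h₁
        tauto

/-- The typing behind the extrusion of a buffer along a link `x ↔ y`. The messages of `B`, sent on `x`
to a process that forwards `x` to `y` after the messages of `B'`, may be sent on `y` in advance, since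
the type of `y` can anticipate outputs. -/
theorem BufferTyped.forward (hD : D.WellFormed) {y : Chan} {B' : Buffer Tag Nm} {k l : ℕ}
    {U₁ U₂ Z : Tree Tag} (hy : y ∉ B.fn) (h : BufferTyped D G x k B S U₁) (hU : Correct U₁ U₂)
    (h' : BufferTyped D G' x l B' V U₂) (hZ : Le V.dual Z) :
    ∃ W U₃ V', BufferTyped D G y k (B.subst x y) W Z ∧ BufferTyped D G' x l B' V' U₃ ∧
      Correct S U₃ ∧ Le V'.dual W := by
  induction B generalizing k U₁ U₂ V Z with
  | nil => exact ⟨Z, U₂, V, Le.refl _, h', Le.correct h hU, hZ⟩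
  | cons M B ih =>
    cases M with
    | tag a =>
      obtain ⟨k', m, W₀, hn, hW₀, h⟩ := h
      obtain ⟨U₂', hU₂, hU⟩ := isCorrectComp_correct.oi _ _ (hW₀.correct hU) _ _ (by simp)
        (Tree.trans_outTag a m W₀)
      obtain ⟨V₁, hV₁, h'⟩ := h'.trans_tag hU₂
      obtain ⟨W, U₃, V', h₁, h₂⟩ := ih hy h hU h' (Le.refl _)
      exact ⟨W, U₃, V', ⟨k', m, V₁.dual, hn, (Le.outTag hV₁.dual).trans hZ, h₁⟩, h₂⟩
    | chan u R =>
      obtain ⟨k', l', T, W₀, hn, hW₀, hR, h, hd⟩ := h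
      obtain ⟨T₁, U₂', hU₂, hT, hU⟩ := isCorrectComp_correct.ois _ _ (hW₀.correct hU) _ _
        (Trans.mustMult true T W₀)
      obtain ⟨T₁', V₁, hV₁, hT₁, h'⟩ := h'.trans_chan hU₂
      rw [Buffer.fn, Finset.mem_union, not_or] at hy
      obtain ⟨W, U₃, V', h₁, h₂⟩ := ih hy.2 h hU h' (Le.refl _)
      have hx : x ∉ R.fn.erase u := Finset.disjoint_right.1 hd (Finset.mem_insert_self _ _)
      have hid : ∀ z ∈ R.fn.erase u, Function.update id x y z = z := by
        intro z hz
        rw [Function.update_of_ne]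
        · rfl
        · rintro rfl; exact hx hz
      have himg := image_update_id (y := y) hx
      have hfresh := fresh_notMem ((R.fn.erase u).image (Function.update id x y))
      have hxB := h.notMem
      refine ⟨W, U₃, V', ⟨k', l', T, V₁.dual, hn, Le.trans ?_ hZ, ?_, h₁, ?_⟩, h₂⟩
      · exact (Correct.mult hV₁ (hT₁.correct hT.symm) (correct_dual V₁)).symm.le_dual
      · refine hR.rename hD (injOn_update hfresh ?_) fun z hz => ?_
        · intro a ha b hb hab
          rwa [hid a ha, hid b hb] at hab
        · by_cases hzu : z = u
          · simp [hzu, Le.refl]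
          · have hz' : z ∈ R.fn.erase u := Finset.mem_erase.2 ⟨hzu, hz⟩
            rw [Function.update_of_ne hzu, Function.update_of_ne hzu, hid z hz',
              Function.update_of_ne]
            · exact Le.refl _
            · rintro rfl
              exact hfresh (himg.symm ▸ hz')
      · rw [Proc.fn_rename, image_update hfresh, himg, Buffer.fn_subst, image_update_id hxB]
        rw [Finset.disjoint_insert_right] at hd ⊢
        exact ⟨hy.1, hd.2⟩

end

/-! ### Structural pre-congruence preserves affine typing -/

section

variable {Tag Nm : Type} {D : Program Tag Nm}

theorem StrStep.fn_subset (hD : D.WellFormed) {P Q : Proc Tag Nm} (h : StrStep D P Q) :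
    Q.fn ⊆ P.fn := by
  intro w
  cases h with
  | alpha h => rw [h.fn_eq]; exact id
  | call h => exact fun hw => hD.fn_unfold_subset h hw
  | link => simp only [Proc.fn, Finset.mem_insert, Finset.mem_singleton]; tauto
  | comm => simp only [Proc.fn, Finset.mem_erase, Finset.mem_union]; tauto
  | wait B h =>
    simp only [Proc.fn, Finset.mem_insert, Finset.mem_erase, Finset.mem_union, Buffer.mem_fn_fill]
    rintro (rfl | h') <;> tauto
  | @case x y I P Q B h =>
    simp only [Proc.fn, Finset.mem_insert, Finset.mem_erase, Finset.mem_union, Finset.mem_biUnion,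
      Buffer.mem_fn_fill]
    rintro (rfl | ⟨a, ha, hw, h'⟩)
    · tauto
    · rcases h' with (h' | h' | h') | h'
      · tauto
      · tauto
      · exact ⟨hw, Or.inl (Or.inr (Or.inr (Or.inr ⟨a, ha, h'⟩)))⟩
      · tauto
  | join B h hB hz hQ =>
    simp only [Proc.fn, Finset.mem_insert, Finset.mem_erase, Finset.mem_union, Buffer.mem_fn_fill]
    rintro (rfl | h') <;> tauto
  | @pull0 x y P B B' h =>
    simp only [Proc.fn, Finset.mem_insert, Finset.mem_erase, Finset.mem_union, Buffer.mem_fn_fill,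
      Finset.mem_singleton, Buffer.fn_subst, Finset.mem_image]
    rintro (⟨-, rfl⟩ | ⟨a, ha, rfl⟩ | h')
    · tauto
    · by_cases hax : a = x
      · subst hax
        simp only [Function.update_self]
        exact ⟨h.symm, by tauto⟩
      · simp only [Function.update_of_ne hax, id]
        tauto
    · tauto
  | pull1 h hP hQ hz hR =>
    simp only [Proc.fn, Finset.mem_insert, Finset.mem_erase, Finset.mem_union]
    rintro (rfl | h' | h')
    · tauto
    · tauto
    · exact ⟨by rintro rfl; exact hQ h', by tauto⟩
  | pull2 B h hB =>
    simp only [Proc.fn, Finset.mem_erase, Finset.mem_union, Buffer.mem_fn_fill]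
    rintro (⟨h', rfl⟩ | h' | h')
    · tauto
    · exact ⟨by rintro rfl; exact hB h', by tauto⟩
    · tauto
  | pull3 B h hP hz hB =>
    simp only [Proc.fn, Finset.mem_insert, Finset.mem_erase, Finset.mem_union, Buffer.mem_fn_fill]
    tauto
  | pull4 B B' h hP =>
    simp only [Buffer.mem_fn_fill]
    tauto

theorem Str.fn_subset (hD : D.WellFormed) {P Q : Proc Tag Nm} (h : Str D P Q) : Q.fn ⊆ P.fn :=
  PreCong.fn_subset (fun _ _ h => h.fn_subset hD) h

/-- Each axiom of structural pre-congruence preserves affine typing. Apart from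
alpha-equivalence, links and the buffers forwarded along them, the derivation is merely rearranged;
the disjointness conditions show that the contexts differ only at channels that do not occur. -/
theorem StrStep.affine (hD : D.WellFormed) {P Q : Proc Tag Nm} (h : StrStep D P Q) {n : ℕ}
    {G : Chan → Tree Tag} (hP : Affine D n P G) : Affine D n Q G := by
  cases h with
  | alpha h => exact hP.alpha hD h
  | call h => exact hP.unfold.2
  | link =>
    obtain ⟨hxy, hn, hS⟩ := hP.unfold
    exact .fold ⟨hxy.symm, hn, by simpa using hS.dual⟩
  | comm =>
    obtain ⟨k, l, S, T, hn, hS, h₁, h₂, hd⟩ := hP.unfold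
    exact .fold ⟨l, k, T, S, by omega, hS.symm, h₂, h₁, hd.symm⟩
  | @wait x y P Q B hxy =>
    obtain ⟨k, l, S, T, hn, hS, h₁, h₂, hd⟩ := hP.unfold
    obtain ⟨i, j, V, hk, hB, h₁, hd'⟩ := (affine_fill hD).1 h₁
    obtain ⟨hy, hle, h₁⟩ := h₁.unfold
    simp only [Finset.disjoint_left, Proc.fn, Finset.mem_insert, Finset.mem_erase,
      Buffer.mem_fn_fill] at hd hd'
    have hyB : y ∉ B.fn := fun h => hd' h (Or.inl rfl)
    have hyQ : y ∉ Q.fn := fun h => hd (a := y) ⟨hxy.symm, by tauto⟩ ⟨hxy.symm, h⟩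
    rw [Function.update_of_ne hxy.symm, Function.update_of_ne hxy.symm] at hle
    refine .fold ⟨?_, hle, .fold ⟨k, l, S, T, hn, hS,
      (affine_fill hD).2 ⟨i, j, V, hk, hB, h₁, ?_⟩, h₂, ?_⟩⟩
    · simp only [Proc.fn, Finset.mem_erase, Finset.mem_union, Buffer.mem_fn_fill]
      tauto
    · exact Finset.disjoint_left.2 fun z hz hz' => hd' hz (Or.inr hz')
    · simp only [Finset.disjoint_left, Finset.mem_erase, Buffer.mem_fn_fill]
      rintro z ⟨hz, h⟩
      exact hd ⟨hz, by tauto⟩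
  | @case x y I P Q B hxy =>
    obtain ⟨k, l, S, T, hn, hS, h₁, h₂, hd⟩ := hP.unfold
    obtain ⟨i, j, V, hk, hB, h₁, hd'⟩ := (affine_fill hD).1 h₁
    obtain ⟨J, m, f, hle, h₁⟩ := h₁.unfold
    simp only [Finset.disjoint_left, Proc.fn, Finset.mem_insert, Finset.mem_erase,
      Buffer.mem_fn_fill, Finset.mem_biUnion] at hd hd'
    have hyB : y ∉ B.fn := fun h => hd' h (Or.inl rfl)
    have hyQ : y ∉ Q.fn := fun h => hd (a := y) ⟨hxy.symm, by tauto⟩ ⟨hxy.symm, h⟩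
    have hsub : ∀ (a : {a // a ∈ I}) z, z ∈ (P a).fn → ∃ a ∈ I.attach, z ∈ (P a).fn :=
      fun a z h => ⟨a, Finset.mem_attach _ _, h⟩
    rw [Function.update_of_ne hxy.symm, Function.update_of_ne hxy.symm] at hle
    refine .fold ⟨J, m, f, hle, fun a => ⟨(h₁ a).1, .fold ⟨k + m a, l, S, T, by omega, hS,
      (affine_fill hD).2 ⟨i, j + m a, V, by omega, ?_, ?_, ?_⟩, ?_, ?_⟩⟩⟩
    · rw [Function.update_self]
      rw [Function.update_self] at hB
      refine hB.congr hD (update_eq_of_eq fun z hz _ => ?_)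
      rw [Function.update_of_ne]
      rintro rfl
      exact hyB hz
    · have h₁ := (h₁ a).2
      rw [Function.update_idem] at h₁ ⊢
      rwa [Function.update_comm hxy.symm]
    · exact Finset.disjoint_left.2 fun z hz hz' => hd' hz (Or.inr (hsub _ _ hz'))
    · refine h₂.congr hD (update_eq_of_eq fun z hz _ => ?_)
      rw [Function.update_of_ne]
      rintro rfl
      exact hyQ hz
    · simp only [Finset.disjoint_left, Finset.mem_erase, Buffer.mem_fn_fill]
      rintro z ⟨hz, h⟩
      have := hsub ⟨a, (h₁ a).1⟩ z
      exact hd ⟨hz, by tauto⟩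
  | @join x y z P Q B hxy hzB hzx hzQ =>
    obtain ⟨k, l, S, T, hn, hS, h₁, h₂, hd⟩ := hP.unfold
    obtain ⟨i, j, V, hk, hB, h₁, hd'⟩ := (affine_fill hD).1 h₁
    obtain ⟨T', S', hle, h₁⟩ := h₁.unfold
    simp only [Finset.disjoint_left, Proc.fn, Finset.mem_insert, Finset.mem_erase,
      Buffer.mem_fn_fill] at hd hd'
    have hyB : y ∉ B.fn := fun h => hd' h (Or.inl rfl)
    have hyQ : y ∉ Q.fn := fun h => hd (a := y) ⟨hxy.symm, by tauto⟩ ⟨hxy.symm, h⟩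
    have hupd : ∀ (s : Finset Chan), y ∉ s → z ∉ s → ∀ w ∈ s,
        G w = Function.update (Function.update G y S') z T' w := by
      intro s hy hz w hw
      rw [Function.update_of_ne, Function.update_of_ne]
      · rintro rfl; exact hy hw
      · rintro rfl; exact hz hw
    rw [Function.update_of_ne hxy.symm, Function.update_of_ne hxy.symm] at hle
    refine .fold ⟨T', S', hle, .fold ⟨k, l, S, T, hn, hS,
      (affine_fill hD).2 ⟨i, j, V, hk, ?_, ?_, ?_⟩, ?_, ?_⟩⟩
    · rw [Function.update_self]
      rw [Function.update_self] at hB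
      exact hB.congr hD (update_eq_of_eq fun w hw _ => hupd _ hyB hzB w hw)
    · rw [Function.update_idem] at h₁ ⊢
      rwa [Function.update_comm hzx, Function.update_comm hxy.symm]
    · refine Finset.disjoint_left.2 fun w hw hw' => hd' hw (Or.inr ⟨?_, hw'⟩)
      rintro rfl
      exact hzB hw
    · exact h₂.congr hD (update_eq_of_eq fun w hw _ => hupd _ hyQ hzQ w hw)
    · simp only [Finset.disjoint_left, Finset.mem_erase, Buffer.mem_fn_fill]
      rintro w ⟨hw, h⟩
      by_cases hwz : w = z
      · rw [hwz]; tauto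
      · exact hd ⟨hw, by tauto⟩
  | @pull0 x y P B B' hxy =>
    obtain ⟨k, l, S, T, hn, hS, h₁, h₂, hd⟩ := hP.unfold
    obtain ⟨i, j, V, hk, hB, h₁, hd₁⟩ := (affine_fill hD).1 h₁
    obtain ⟨i', j', V', hk', hB', h₂, hd₂⟩ := (affine_fill hD).1 h₂
    obtain ⟨-, hj, hV⟩ := h₂.unfold
    simp only [Finset.disjoint_left, Proc.fn, Finset.mem_insert, Finset.mem_erase,
      Buffer.mem_fn_fill, Finset.mem_singleton] at hd hd₁ hd₂
    have hyB : y ∉ B.fn := fun h => hd (a := y) ⟨hxy.symm, by tauto⟩ ⟨hxy.symm, by tauto⟩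
    have hyP : y ∉ P.fn := fun h => hd (a := y) ⟨hxy.symm, by tauto⟩ ⟨hxy.symm, by tauto⟩
    have hyB' : y ∉ B'.fn := fun h => hd₂ h (Or.inr rfl)
    have hxB := hB.notMem
    rw [Function.update_self] at hB hB'
    rw [Function.update_self, Function.update_of_ne hxy.symm, Function.update_of_ne hxy.symm] at hV
    obtain ⟨W, U₃, V'', hB, hB', hS, hV⟩ := hB.forward hD hyB hS hB' hV
    have hBfn : (B.subst x y).fn = B.fn := by rw [Buffer.fn_subst, image_update_id hxB]
    refine (affine_fill hD).2 ⟨i, j + l, W, ?_, hB.congr hD fun z hz => ?_, .fold ⟨j, l, V, U₃,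
      le_rfl, hS, ?_, (affine_fill hD).2 ⟨i', j', V'', hk', ?_, .fold ⟨hxy, hj, ?_⟩, ?_⟩, ?_⟩, ?_⟩
    · omega
    · rw [Function.update_of_ne]
      rintro rfl
      rw [hBfn] at hz
      exact hxB hz
    · rw [Function.update_idem] at h₁
      refine h₁.congr hD (update_eq_of_eq fun z hz _ => ?_)
      rw [Function.update_of_ne]
      rintro rfl
      exact hyP hz
    · rw [Function.update_self]
      refine hB'.congr hD fun z hz => ?_
      have hzx : z ≠ x := by rintro rfl; exact hB'.notMem hz
      have hzy : z ≠ y := by rintro rfl; exact hyB' hz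
      rw [Function.update_of_ne hzx, Function.update_of_ne hzx, Function.update_of_ne hzy]
    · simpa [hxy.symm] using hV
    · simp only [Finset.disjoint_left, Proc.fn, Finset.mem_insert, Finset.mem_singleton]
      exact hd₂
    · simp only [Finset.disjoint_left, Proc.fn, Finset.mem_insert, Finset.mem_erase,
        Buffer.mem_fn_fill, Finset.mem_singleton]
      rintro z ⟨hz, h⟩
      exact hd ⟨hz, by tauto⟩
    · rw [hBfn]
      simp only [Finset.disjoint_left, Proc.fn, Finset.mem_insert, Finset.mem_erase,
        Buffer.mem_fn_fill, Finset.mem_singleton, Finset.mem_union]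
      rintro z hz ⟨hzx, h | h⟩
      · exact hd₁ hz h
      · exact hd (a := z) ⟨hzx, by tauto⟩ ⟨hzx, h⟩
  | @pull1 x y z P Q R hxy hP' hQ hzx hR =>
    obtain ⟨k, l, S, T, hn, hS, h₁, h₂, hd⟩ := hP.unfold
    obtain ⟨i, j, T', S', hk, hle, h₁, h₃, hd'⟩ := h₁.unfold
    simp only [Finset.disjoint_left, Proc.fn, Finset.mem_insert, Finset.mem_erase,
      Finset.mem_union] at hd hd'
    rw [Function.update_of_ne hxy.symm] at hle
    refine .fold ⟨i + l, j, T', S', by omega, hle,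
      .fold ⟨i, l, S, T, le_rfl, hS, ?_, ?_, ?_⟩, ?_, ?_⟩
    · rwa [Function.update_comm hzx]
    · refine h₂.congr hD (update_eq_of_eq fun w hw _ => ?_)
      rw [Function.update_of_ne]
      rintro rfl
      exact hR hw
    · simp only [Finset.disjoint_left, Finset.mem_erase]
      rintro w ⟨hw, h⟩
      by_cases hwz : w = z
      · rw [hwz]; tauto
      · exact hd ⟨hw, by tauto⟩
    · refine h₃.congr hD (update_eq_of_eq fun w hw _ => ?_)
      rw [Function.update_of_ne]
      rintro rfl
      exact hQ hw
    · simp only [Finset.disjoint_left, Proc.fn, Finset.mem_insert, Finset.mem_erase,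
        Finset.mem_union]
      rintro w ⟨hwz, hwx, h | h⟩ h'
      · exact hd' ⟨hwz, h⟩ h'
      · exact hd (a := w) ⟨hwx, by tauto⟩ ⟨hwx, h⟩
  | @pull2 x y P Q B hxy hxB =>
    obtain ⟨k, l, S, T, hn, hS, h₁', h₂, hd⟩ := hP.unfold
    obtain ⟨i, j, V, hk, hB, h₁, hd'⟩ := (affine_fill hD).1 h₁'
    simp only [Finset.disjoint_left, Finset.mem_erase, Buffer.mem_fn_fill] at hd hd'
    rw [Function.update_of_ne hxy.symm] at hB
    cases B with
    | nil =>
      refine .fold ⟨k, l, S, T, hn, hS, h₁', h₂, ?_⟩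
      simp only [Finset.disjoint_left, Finset.mem_erase]
      rintro z ⟨hz, h⟩
      exact hd ⟨hz, Or.inr (Or.inr h)⟩
    | cons M B =>
      have hyQ : y ∉ Q.fn := fun h => hd (a := y) ⟨hxy.symm, by simp⟩ ⟨hxy.symm, h⟩
      refine (affine_fill hD).2 ⟨i, j + l, V, by omega, hB.congr hD fun z hz => ?_,
        .fold ⟨j, l, S, T, le_rfl, hS, ?_, ?_, ?_⟩, ?_⟩
      · rw [Function.update_of_ne]
        rintro rfl
        exact hxB hz
      · rwa [Function.update_comm hxy.symm]
      · refine h₂.congr hD (update_eq_of_eq fun z hz _ => ?_)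
        rw [Function.update_of_ne]
        rintro rfl
        exact hyQ hz
      · simp only [Finset.disjoint_left, Finset.mem_erase]
        rintro z ⟨hz, h⟩
        exact hd ⟨hz, by tauto⟩
      · simp only [Finset.disjoint_left, Proc.fn, Finset.mem_erase, Finset.mem_union]
        rintro z hz ⟨hzx, h | h⟩
        · exact hd' hz h
        · exact hd (a := z) ⟨hzx, by tauto⟩ ⟨hzx, h⟩
  | @pull3 x y z P Q B hxy hxP hzx hzB =>
    obtain ⟨k, l, V, hn, hB, h, hd⟩ := (affine_fill hD).1 hP
    obtain ⟨i, j, T, S, hl, hle, h₁, h₂, hd'⟩ := h.unfold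
    simp only [Finset.disjoint_left, Proc.fn, Finset.mem_insert, Finset.mem_erase,
      Finset.mem_union] at hd hd'
    rw [Function.update_of_ne hxy.symm] at hle
    have hxQ : x ∉ Q.fn := fun h => hd' ⟨hzx.symm, hxP⟩ (Or.inr h)
    refine .fold ⟨k + i, j, T, S, by omega, hle,
      (affine_fill hD).2 ⟨k, i, V, le_rfl, ?_, ?_, ?_⟩, ?_, ?_⟩
    · rw [Function.update_of_ne hzx.symm]
      refine hB.congr hD fun w hw => ?_
      rw [Function.update_of_ne]
      rintro rfl
      exact hzB hw
    · rwa [Function.update_comm hzx]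
    · refine Finset.disjoint_left.2 fun w hw hw' => hd hw (Or.inr (Or.inl ⟨?_, hw'⟩))
      rintro rfl
      exact hzB hw
    · refine h₂.congr hD (update_eq_of_eq fun w hw _ => ?_)
      rw [Function.update_of_ne]
      rintro rfl
      exact hxQ hw
    · simp only [Finset.disjoint_left, Finset.mem_insert, Finset.mem_erase, Buffer.mem_fn_fill]
      rintro w ⟨hwz, h | h | h⟩
      · rw [h.2]; tauto
      · have := hd h
        tauto
      · exact hd' ⟨hwz, h⟩
  | @pull4 x y P B B' hxy hxP =>
    obtain ⟨k, l, V, hn, hB, h, hd⟩ := (affine_fill hD).1 hP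
    obtain ⟨i, j, W, hl, hB', h, hd'⟩ := (affine_fill hD).1 h
    simp only [Finset.disjoint_left, Buffer.mem_fn_fill] at hd hd'
    rw [Function.update_of_ne hxy.symm] at hB'
    have hxB' : x ∉ B'.fn := fun h => hd' h hxP
    by_cases hy : B' = []
    · subst hy
      exact hP
    · have hyB : y ∉ B.fn := fun h => hd h (Or.inl ⟨hy, rfl⟩)
      refine (affine_fill hD).2 ⟨i, k + j, W, by omega, hB'.congr hD fun z hz => ?_,
        (affine_fill hD).2 ⟨k, j, V, le_rfl, ?_, ?_, ?_⟩, ?_⟩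
      · rw [Function.update_of_ne]
        rintro rfl
        exact hxB' hz
      · rw [Function.update_of_ne hxy]
        refine hB.congr hD fun z hz => ?_
        rw [Function.update_of_ne]
        rintro rfl
        exact hyB hz
      · rwa [Function.update_comm hxy.symm]
      · exact Finset.disjoint_left.2 fun z hz hz' => hd hz (Or.inr (Or.inr hz'))
      · simp only [Finset.disjoint_left, Buffer.mem_fn_fill]
        rintro z hz (h | h | h)
        · rw [h.2] at hz
          exact hxB' hz
        · exact hd h (Or.inr (Or.inl hz))
        · exact hd' hz h

/-- Structural pre-congruence preserves affine typing, its measure and its context. -/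
theorem Str.affine (hD : D.WellFormed) {P Q : Proc Tag Nm} (h : Str D P Q) {n : ℕ}
    {G : Chan → Tree Tag} (hP : Affine D n P G) : Affine D n Q G := by
  unfold Str at h
  induction h generalizing n G with
  | base h => exact h.affine hD hP
  | refl => exact hP
  | trans _ _ ih₁ ih₂ => exact ih₂ (ih₁ hP)
  | select x a _ ih =>
    obtain ⟨k, m, S, hn, hS, h⟩ := hP.unfold
    exact .fold ⟨k, m, S, hn, hS, ih h⟩
  | fork x y h₁ h₂ ih₁ ih₂ =>
    obtain ⟨k, l, T, S, hn, hS, hP, hQ, hd⟩ := hP.unfold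
    exact .fold ⟨k, l, T, S, hn, hS, ih₁ hP, ih₂ hQ, hd.mono
      (Finset.erase_subset_erase _ (Str.fn_subset hD h₁))
      (Finset.insert_subset_insert _ (Str.fn_subset hD h₂))⟩
  | choice => exact hP.unfold.elim
  | wait x h ih =>
    obtain ⟨hx, hS, hP⟩ := hP.unfold
    exact .fold ⟨fun h' => hx (Str.fn_subset hD h h'), hS, ih hP⟩
  | case x I _ ih =>
    obtain ⟨J, m, S, hS, h⟩ := hP.unfold
    exact .fold ⟨J, m, S, hS, fun a => ⟨(h a).1, ih _ (h a).2⟩⟩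
  | join x y _ ih =>
    obtain ⟨T, S, hS, h⟩ := hP.unfold
    exact .fold ⟨T, S, hS, ih h⟩
  | cut x h₁ h₂ ih₁ ih₂ =>
    obtain ⟨k, l, S, T, hn, hS, hP, hQ, hd⟩ := hP.unfold
    exact .fold ⟨k, l, S, T, hn, hS, ih₁ hP, ih₂ hQ, hd.mono
      (Finset.erase_subset_erase _ (Str.fn_subset hD h₁))
      (Finset.erase_subset_erase _ (Str.fn_subset hD h₂))⟩

end

/-! ### Reduction decreases the measure -/

section

variable {Tag Nm : Type} {D : Program Tag Nm}

/-- Reduction strictly decreases the measure of affine typing, in the same context. The inclusion of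
free channels is needed to keep the parts of a composition disjoint; it may fail for the reduction of
an untypable link `x ↔ x`, so it is proved together with typing. -/
theorem Red.affine (hD : D.WellFormed) {P Q : Proc Tag Nm} (h : Red D P Q) {n : ℕ}
    {G : Chan → Tree Tag} (hP : Affine D n P G) :
    Q.fn ⊆ P.fn ∧ ∃ m < n, Affine D m Q G := by
  induction h generalizing n G with
  | choiceL | choiceR => exact hP.unfold.elim
  | @link x y P =>
    obtain ⟨k, l, S, T, hn, hS, h₁, h₂, hd⟩ := hP.unfold
    obtain ⟨hxy, hk, hle⟩ := h₁.unfold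
    simp only [Finset.disjoint_left, Proc.fn, Finset.mem_insert, Finset.mem_erase,
      Finset.mem_singleton] at hd
    have hyP : y ∉ P.fn := fun h => hd (a := y) ⟨hxy.symm, Or.inr rfl⟩ ⟨hxy.symm, h⟩
    rw [Function.update_self, Function.update_of_ne hxy.symm] at hle
    refine ⟨?_, l, by omega, h₂.rename hD (injOn_update ?_ (Set.injOn_id _)) fun z hz => ?_⟩
    · rw [Proc.subst, Proc.fn_rename]
      intro w hw
      obtain ⟨z, hz, rfl⟩ := Finset.mem_image.1 hw
      simp only [Proc.fn, Finset.mem_erase, Finset.mem_union, Finset.mem_insert,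
        Finset.mem_singleton]
      by_cases hzx : z = x
      · subst hzx
        rw [Function.update_self]
        exact ⟨hxy.symm, by tauto⟩
      · rw [Function.update_of_ne hzx]
        exact ⟨hzx, Or.inr hz⟩
    · rw [Finset.image_id]
      exact fun h => hyP (Finset.mem_of_mem_erase h)
    · by_cases hzx : z = x
      · rw [hzx, Function.update_self, Function.update_self]
        exact hS.symm.le_dual.trans hle
      · rw [Function.update_of_ne hzx, Function.update_of_ne hzx]
        exact Le.refl _
  | @close x P =>
    obtain ⟨k, l, S, T, hn, hS, h₁, h₂, hd⟩ := hP.unfold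
    have hk := h₁.unfold.1
    obtain ⟨hx, -, h₂⟩ := h₂.unfold
    refine ⟨fun z hz => ?_, l, by omega, h₂.congr hD fun z hz => ?_⟩
    · simp only [Proc.fn, Finset.mem_erase, Finset.mem_union, Finset.mem_insert]
      exact ⟨by rintro rfl; exact hx hz, by tauto⟩
    · rw [Function.update_of_ne]
      rintro rfl
      exact hx hz
  | @select x I P Q B a =>
    obtain ⟨k, l, S, T, hn, hS, h₁, h₂, hd⟩ := hP.unfold
    obtain ⟨k', m, S', hk, hle, h₁⟩ := h₁.unfold
    obtain ⟨i, j, V, hl, hB, h₂, hd'⟩ := (affine_fill hD).1 h₂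
    obtain ⟨J, m', f, hle', h₂⟩ := h₂.unfold
    rw [Function.update_self] at hle hB hle'
    obtain ⟨T', hT, hS⟩ := isCorrectComp_correct.oi _ _ (hle.correct hS) _ _ (by simp)
      (Tree.trans_outTag a.1 m S')
    obtain ⟨V', hV, hB⟩ := hB.trans_tag hT
    obtain ⟨W, hW, hle'⟩ := hle'.trans_tag hV
    obtain ⟨⟨b, hb⟩, e, rfl⟩ := hW.branch_inv_must
    obtain ⟨rfl, rfl⟩ : a.1 = b ∧ m = m' ⟨b, hb⟩ := by simpa using e
    -- The receiver's measure grows by the annotation of the tag, which the sender has in reserve.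
    have h₂ := (h₂ ⟨a, hb⟩).2
    have hsub : (Q a).fn ⊆ (Proc.case x I Q).fn := fun z hz => by
      simp only [Proc.fn, Finset.mem_insert, Finset.mem_biUnion]
      exact Or.inr ⟨_, Finset.mem_attach _ _, hz⟩
    have hsub' : (B.fill x (Q a)).fn ⊆ (B.fill x (Proc.case x I Q)).fn := fun z hz => by
      rw [Buffer.mem_fn_fill] at hz ⊢
      exact hz.imp_right (Or.imp_right fun h => hsub h)
    refine ⟨?_, k' + l + m' ⟨a, hb⟩, by omega, .fold ⟨k', l + m' ⟨a, hb⟩, S', T', by omega, hS, ?_,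
      (affine_fill hD).2 ⟨i, j + m' ⟨a, hb⟩, V', by omega, ?_, ?_, hd'.mono_right hsub⟩, ?_⟩⟩
    · exact Finset.erase_subset_erase _
        (Finset.union_subset_union (Finset.subset_insert _ _) hsub')
    · rwa [Function.update_idem] at h₁
    · rw [Function.update_self]
      refine hB.congr hD fun z hz => ?_
      have hzx : z ≠ x := by rintro rfl; exact hB.notMem hz
      rw [Function.update_of_ne hzx, Function.update_of_ne hzx]
    · rw [Function.update_idem, Function.update_idem] at h₂
      refine h₂.weaken hD le_rfl fun z hz => ?_
      rw [Function.update_idem]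
      by_cases hzx : z = x
      · rw [hzx, Function.update_self, Function.update_self]
        exact hle'
      · rw [Function.update_of_ne hzx, Function.update_of_ne hzx]
        exact Le.refl _
    · exact hd.mono (Finset.erase_subset_erase _ (Finset.subset_insert _ _))
        (Finset.erase_subset_erase _ hsub')
  | @fork x y P Q R B hyx hyQ hyB =>
    obtain ⟨k, l, S, T, hn, hS, h₁, h₂, hd⟩ := hP.unfold
    obtain ⟨k₁, k₂, U, S', hk, hle, h₁, h₃, hd₁⟩ := h₁.unfold
    obtain ⟨i, j, V, hl, hB, h₂, hd₂⟩ := (affine_fill hD).1 h₂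
    obtain ⟨U', W, hle', h₂⟩ := h₂.unfold
    rw [Function.update_self] at hle hB hle'
    obtain ⟨U₁, T', hT, hU, hS⟩ := isCorrectComp_correct.ois _ _ (hle.correct hS) _ _
      (Trans.mustMult true U S')
    obtain ⟨U₂, V', hV, hU₂, hB⟩ := hB.trans_chan hT
    obtain ⟨U₃, W', hW, hU₃, hle₂⟩ := hle'.trans_chan hV
    obtain ⟨e, rfl⟩ := hW.mult_inv_must
    cases e
    simp only [Finset.disjoint_left, Proc.fn, Finset.mem_insert, Finset.mem_erase,
      Finset.mem_union, Buffer.mem_fn_fill] at hd hd₁ hd₂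
    have hxP : x ∉ P.fn := fun h => hd₁ ⟨hyx.symm, h⟩ (Or.inl rfl)
    refine ⟨?_, k₁ + (k₂ + l), by omega, .fold ⟨k₁, k₂ + l, U, U', le_rfl,
      ((hU₃.trans hU₂).correct hU.symm).symm, ?_, .fold ⟨k₂, l, S', T', le_rfl, hS, ?_,
        (affine_fill hD).2 ⟨i, j, V', hl, ?_, ?_, ?_⟩, ?_⟩, ?_⟩⟩
    · intro z
      simp only [Proc.fn, Finset.mem_insert, Finset.mem_erase, Finset.mem_union,
        Buffer.mem_fn_fill]
      rintro ⟨hzy, h | h⟩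
      · exact ⟨by rintro rfl; exact hxP h, by tauto⟩
      · tauto
    · refine h₁.congr hD (update_eq_of_eq fun z hz _ => ?_)
      rw [Function.update_of_ne]
      rintro rfl
      exact hxP hz
    · rw [Function.update_idem] at h₃
      refine h₃.congr hD (update_eq_of_eq fun z hz _ => ?_)
      rw [Function.update_of_ne]
      rintro rfl
      exact hyQ hz
    · rw [Function.update_self]
      refine hB.congr hD fun z hz => ?_
      have hzx : z ≠ x := by rintro rfl; exact hB.notMem hz
      have hzy : z ≠ y := by rintro rfl; exact hyB hz
      rw [Function.update_of_ne hzx, Function.update_of_ne hzx, Function.update_of_ne hzy]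
    · rw [Function.update_idem, Function.update_idem] at h₂
      refine h₂.weaken hD le_rfl fun z hz => ?_
      rw [Function.update_idem]
      by_cases hzy : z = y
      · rw [hzy, Function.update_self, Function.update_of_ne hyx, Function.update_self]
        exact Le.refl _
      · by_cases hzx : z = x
        · rw [hzx, Function.update_of_ne hyx.symm, Function.update_self, Function.update_self]
          exact hle₂
        · rw [Function.update_of_ne hzy, Function.update_of_ne hzx, Function.update_of_ne hzx,
            Function.update_of_ne hzy]
          exact Le.refl _
    · refine Finset.disjoint_left.2 fun z hz hz' => hd₂ hz (Or.inr ⟨?_, hz'⟩)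
      rintro rfl
      exact hyB hz
    · simp only [Finset.disjoint_left, Finset.mem_erase, Buffer.mem_fn_fill]
      rintro z ⟨hzx, hz⟩ ⟨-, h⟩
      have hzy : z ≠ y := by rintro rfl; exact hyQ hz
      exact hd (a := z) ⟨hzx, by tauto⟩ ⟨hzx, by tauto⟩
    · simp only [Finset.disjoint_left, Proc.fn, Finset.mem_erase, Finset.mem_union,
        Buffer.mem_fn_fill]
      rintro z ⟨hzy, hz⟩ ⟨-, hzx, h | h⟩
      · exact hd₁ ⟨hzy, hz⟩ (Or.inr h)
      · exact hd (a := z) ⟨hzx, by tauto⟩ ⟨hzx, by tauto⟩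
  | cut _ ih =>
    obtain ⟨k, l, S, T, hn, hS, h₁, h₂, hd⟩ := hP.unfold
    obtain ⟨hsub, m, hm, h₁⟩ := ih h₁
    exact ⟨Finset.erase_subset_erase _ (Finset.union_subset_union hsub (Finset.Subset.refl _)),
      m + l, by omega, .fold ⟨m, l, S, T, le_rfl, hS, h₁, h₂,
        hd.mono_left (Finset.erase_subset_erase _ hsub)⟩⟩
  | buffer B _ ih =>
    obtain ⟨k, l, S, hn, hB, h, hd⟩ := (affine_fill hD).1 hP
    obtain ⟨hsub, m, hm, h⟩ := ih h
    refine ⟨fun z hz => ?_, k + m, by omega,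
      (affine_fill hD).2 ⟨k, m, S, le_rfl, hB, h, hd.mono_right hsub⟩⟩
    rw [Buffer.mem_fn_fill] at hz ⊢
    exact hz.imp_right (Or.imp_right fun h => hsub h)
  | str hs _ ih =>
    obtain ⟨hsub, h⟩ := ih (hs.affine hD hP)
    exact ⟨hsub.trans (hs.fn_subset hD), h⟩

theorem Affine.terminating (hD : D.WellFormed) {n : ℕ} {P : Proc Tag Nm} {G : Chan → Tree Tag}
    (h : Affine D n P G) : Terminating D P := by
  rintro s len ⟨⟨hs, hred⟩, -⟩ rfl
  have key : ∀ i, ∃ m, m + i ≤ n ∧ Affine D m (s i) G := by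
    intro i
    induction i with
    | zero => exact ⟨n, le_rfl, hs ▸ h⟩
    | succ i ih =>
      obtain ⟨m, hm, h⟩ := ih
      obtain ⟨-, m', hm', h⟩ := (hred i le_top).affine hD h
      exact ⟨m', by omega, h⟩
  obtain ⟨m, hm, -⟩ := key (n + 1)
  omega

end

end CaP

theorem mainTheorem12 {Tag Nm : Type} (D : CaP.Program Tag Nm) (hD : D.WellFormed)
    (P : CaP.Proc Tag Nm) (hP : CaP.WellTyped D P) (hc : D.NoChoice P) :
    CaP.Terminating D P := by
  obtain ⟨n, Γ, -, X, hX, h⟩ := hP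
  have hX : CaP.Consistent D X := hX
  refine (hX.affine hD (good := D.Uses P) (G := fun z => (Γ z).getD (.unit true))
    (fun A hA => ⟨hc.2 A hA, fun B hB => .indirect hA hB⟩) h hc.1 (fun A hA => .direct hA)
    fun z hz => ?_).terminating hD
  obtain ⟨S, hS⟩ := Option.ne_none_iff_exists'.1 (hX.fn_subset_dom _ (Nat.lt_succ_self _) h z hz)
  simp [hS]
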